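/- Let $\mathbb{K}$ be a field of characteristic zero, let $n\ge 2$, and let $\mathcal P=\{a_1,\dots,a_m\}$ be $m$ distinct points of a circle, numbered anticlockwise. Cut the circle between $a_m$ and $a_1$, so that $\mathcal P$ becomes linearly ordered by the index; let $\triangle(a-b)\in\{-1,0,1\}$ be $-1,0,1$ according as $a<b$, $a=b$, $a>b$, and define the linking number $$\mathcal J(rx,sy)=\tfrac12\bigl(\triangle(r-x)\triangle(r-y)\triangle(y-x)-\triangle(r-x)\triangle(r-s)\triangle(s-x)\bigr).$$ *Swapping algebra.* Let $\mathcal Z(\mathcal P)$ be the polynomial ring over $\mathbb K$ in the ordered pairs $xy$ ($x,y\in\mathcal P$) modulo the ideal generated by all $xx$. For $c_1,c_2\in\mathbb K$ the $(c_1,c_2)$-swapping bracket is the biderivation of $\mathcal Z(\mathcal P)$ with $\{rx,sy\}_{c_1,c_2}=\mathcal J(rx,sy)\,(c_1\, ry\cdot sx+c_2\, rx\cdot sy)$. Put $\Delta((x_1,\dots,x_k),(y_1,\dots,y_k))=\det(x_iy_j)$. The rank $n$ swapping ring $\mathcal Z_n(\mathcal P)$ is the quotient of $\mathcal Z(\mathcal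 P)$ by the ideal generated by all $(n+1)\times(n+1)$ determinants $\Delta$, and $\mathcal Q_n(\mathcal P)$ is its total fraction ring; the bracket descends to $\mathcal Z_n(\mathcal P)$ and extends to $\mathcal Q_n(\mathcal P)$ by Leibniz's rule. *Determinant quotients.* For points $x_1,\dots,x_{n-1},t,y$ with $x_1,\dots,x_{n-1},y$ distinct, put $$E(x_1,\dots,x_{n-1}\,|\,t,y)=\frac{\Delta((x_1,\dots,x_{n-1},t),(v_1,\dots,v_n))}{\Delta((x_1,\dots,x_{n-1},y),(v_1,\dots,v_n))}\in\mathcal Q_n(\mathcal P),$$ where $v_1,\dots,v_n\in\mathcal P$ are any distinct points. *Bracket on a cell of the Grassmannian.* Let $\mathbf I\subseteq\{1,\dots,m\}$ have $n$ elements. The coordinate ring of the cell $G^{\mathbf I}_{n,m}=\{x_{\mathbf I}\ne 0\}$ is the polynomial ring $\mathbb K[m_{ij}: i\in\mathbf I,\ j\notin\mathbf I]$ in the coordinates $m_{ij}=x_{\mathbf I(i\to j)}/x_{\mathbf I}$. For $\alpha,\beta\in\mathbb K$, the bracket $\{\cdot,\cdot\}_{B_{\alpha,\beta}}$ (the Gekhtman–Shapiro–Vainshtein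 bracket coming from boundary measurements) is the biderivation of this ring with $$\{m_{ij},m_{i'j'}\}_{B_{\alpha,\beta}}=(\alpha-\beta)\,s_=(a_i,a_j,a_{i'},a_{j'})\,m_{ij'}m_{i'j}+(\alpha+\beta)\,\mathcal J(a_ia_j,a_{i'}a_{j'})\,m_{ij}m_{i'j'},$$ where, with $\prec$ denoting strict anticlockwise cyclic order, $s_=$ equals $1$ if $a_i\prec a_{i'}\prec a_{j'}\prec a_j$; $-1$ if $a_{i'}\prec a_i\prec a_j\prec a_{j'}$; $\tfrac12$ if $a_i=a_{i'}\prec a_{j'}\prec a_j$ or $a_i\prec a_{i'}\prec a_{j'}=a_j$; $-\tfrac12$ if $a_{i'}=a_i\prec a_j\prec a_{j'}$ or $a_{i'}\prec a_i\prec a_j=a_{j'}$; and $0$ otherwise. **Statement.** For every $n$-element subset $\mathbf I\subseteq\{1,\dots,m\}$ and all $\alpha,\beta\in\mathbb K$, there is an injective $\mathbb K$-algebra homomorphism $$\theta_{\alpha,\beta}:\mathbb K[m_{ij}: i\in\mathbf I,\ j\notin\mathbf I]\to\mathcal Q_n(\mathcal P),\qquad \theta_{\alpha,\beta}(m_{ij})=E(\widehat{a_i}\,|\,a_j,a_i),$$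 where $\widehat{a_i}$ is the list, in increasing order of index, of the $n-1$ points $a_k$ with $k\in\mathbf I\setminus\{i\}$; for every choice of distinct $v_1,\dots,v_n\in\mathcal P$ the denominator of $E(\widehat{a_i}\,|\,a_j,a_i)$ is a non-zero-divisor of $\mathcal Z_n(\mathcal P)$ and the formula holds. Moreover $\theta_{\alpha,\beta}$ is Poisson for $\{\cdot,\cdot\}_{B_{\alpha,\beta}}$ and the $(\beta-\alpha,\alpha+\beta)$-swapping bracket: $$\theta_{\alpha,\beta}\bigl(\{f,g\}_{B_{\alpha,\beta}}\bigr)=\{\theta_{\alpha,\beta}(f),\theta_{\alpha,\beta}(g)\}_{\beta-\alpha,\alpha+\beta}\quad\text{for all } f,g.$$ -/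

import Mathlib

namespace Swapping

noncomputable section

open MvPolynomial

/-! ### Brackets as biderivations -/

/-- A `K`-bilinear bracket on a commutative `K`-algebra `R` satisfying Leibniz's rule in both
arguments; `D a b` is the bracket `{a, b}`. -/
abbrev Biderivation (K R : Type*) [CommRing K] [CommRing R] [Algebra K R] :=
  Derivation K R (Derivation K R R)

section Generic

variable {K R : Type*} [CommRing K] [CommRing R] [Algebra K R]

/-- The bracket on a polynomial ring with prescribed values on the variables, extended by
Leibniz's rule. -/
def polyBracket {σ : Type*} (c : σ → σ → MvPolynomial σ K) :
    Biderivation K (MvPolynomial σ K) :=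
  mkDerivation K fun p => mkDerivation K (c p)

@[simp]
theorem polyBracket_X {σ : Type*} (c : σ → σ → MvPolynomial σ K) (p q : σ) :
    polyBracket c (X p) (X q) = c p q := by
  simp [polyBracket]

/-- A bracket is compatible with an ideal when it passes to the quotient. -/
structure Compatible (D : Biderivation K R) (I : Ideal R) : Prop where
  left : ∀ a ∈ I, ∀ b, D a b ∈ I
  right : ∀ a, ∀ b ∈ I, D a b ∈ I

/-- A derivation preserving an ideal, on the quotient ring. -/
def derivQuotient (d : Derivation K R R) (I : Ideal R) (h : ∀ b ∈ I, d b ∈ I) :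
    Derivation K (R ⧸ I) (R ⧸ I) :=
  Derivation.liftOfSurjective (f := Ideal.Quotient.mkₐ K I)
    (Ideal.Quotient.mkₐ_surjective K I) (d := d) (by
      intro x hx
      exact Ideal.Quotient.eq_zero_iff_mem.2 (h x (Ideal.Quotient.eq_zero_iff_mem.1 hx)))

@[simp]
theorem derivQuotient_mk (d : Derivation K R R) (I : Ideal R) (h : ∀ b ∈ I, d b ∈ I) (b : R) :
    derivQuotient d I h (Ideal.Quotient.mk I b) = Ideal.Quotient.mk I (d b) :=
  Derivation.liftOfSurjective_apply (f := Ideal.Quotient.mkₐ K I)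
    (Ideal.Quotient.mkₐ_surjective K I) (d := d) (fun x hx =>
      Ideal.Quotient.eq_zero_iff_mem.2 (h x (Ideal.Quotient.eq_zero_iff_mem.1 hx))) b

/-- The bracket induced on the quotient by a compatible ideal. -/
def quotientBracket (D : Biderivation K R) (I : Ideal R) (h : Compatible D I) :
    Biderivation K (R ⧸ I) :=
  have key : ∀ (a : R) (a' : R ⧸ I), Ideal.Quotient.mk I a = a' →
      derivQuotient (D (Quotient.out a')) I (h.right _) = derivQuotient (D a) I (h.right _) := by
    rintro a a' rfl
    ext b
    obtain ⟨b, rfl⟩ := Ideal.Quotient.mk_surjective b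
    rw [derivQuotient_mk, derivQuotient_mk, Ideal.Quotient.eq, ← Derivation.sub_apply, ← map_sub]
    refine h.left _ ?_ _
    rw [← Ideal.Quotient.eq]
    exact Quotient.out_eq _
  Derivation.mk'
    { toFun := fun a => derivQuotient (D (Quotient.out a)) I (h.right _)
      map_add' := by
        intro a b
        obtain ⟨a, rfl⟩ := Ideal.Quotient.mk_surjective a
        obtain ⟨b, rfl⟩ := Ideal.Quotient.mk_surjective b
        rw [key (a + b) _ (map_add _ _ _), key a _ rfl, key b _ rfl]
        ext c
        obtain ⟨c, rfl⟩ := Ideal.Quotient.mk_surjective c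
        simp
      map_smul' := by
        intro k a
        obtain ⟨a, rfl⟩ := Ideal.Quotient.mk_surjective a
        rw [key (k • a) (k • Ideal.Quotient.mk I a) rfl, key a _ rfl]
        ext c
        obtain ⟨c, rfl⟩ := Ideal.Quotient.mk_surjective c
        simp only [derivQuotient_mk, RingHom.id_apply, Derivation.smul_apply]
        rw [Derivation.map_smul]
        rfl }
    (by
      intro a b
      obtain ⟨a, rfl⟩ := Ideal.Quotient.mk_surjective a
      obtain ⟨b, rfl⟩ := Ideal.Quotient.mk_surjective b
      simp only [LinearMap.coe_mk, AddHom.coe_mk]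
      rw [key (a * b) _ (map_mul _ _ _), key a _ rfl, key b _ rfl]
      ext c
      obtain ⟨c, rfl⟩ := Ideal.Quotient.mk_surjective c
      simp)

@[simp]
theorem quotientBracket_mk (D : Biderivation K R) (I : Ideal R) (h : Compatible D I) (a b : R) :
    quotientBracket D I h (Ideal.Quotient.mk I a) (Ideal.Quotient.mk I b) =
      Ideal.Quotient.mk I (D a b) := by
  change derivQuotient (D (Quotient.out (Ideal.Quotient.mk I a))) I (h.right _) _ = _
  rw [derivQuotient_mk, Ideal.Quotient.eq, ← Derivation.sub_apply, ← map_sub]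
  refine h.left _ ?_ _
  rw [← Ideal.Quotient.eq]
  exact Quotient.out_eq _

open KaehlerDifferential TensorProduct in
/-- The unique extension of a derivation to the total ring of fractions. -/
def derivFraction {M : Type*} [AddCommGroup M] [Module K M] [Module R M]
    [Module (FractionRing R) M] [IsScalarTower R (FractionRing R) M] [IsScalarTower K R M]
    [IsScalarTower K (FractionRing R) M]
    (d : Derivation K R M) : Derivation K (FractionRing R) M :=
  haveI : Algebra.FormallyEtale R (FractionRing R) :=
    Algebra.FormallyEtale.of_isLocalization (nonZeroDivisors R)
  ((d.liftKaehlerDifferential.liftBaseChange (FractionRing R)) ∘ₗ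
    (tensorKaehlerEquivOfFormallyEtale K R (FractionRing R)).symm.toLinearMap).compDer
      (KaehlerDifferential.D K (FractionRing R))

theorem derivFraction_algebraMap {M : Type*} [AddCommGroup M] [Module K M] [Module R M]
    [Module (FractionRing R) M] [IsScalarTower R (FractionRing R) M] [IsScalarTower K R M]
    [IsScalarTower K (FractionRing R) M] (d : Derivation K R M) (a : R) :
    derivFraction d (algebraMap R (FractionRing R) a) = d a := by
  have : Algebra.FormallyEtale R (FractionRing R) :=
    Algebra.FormallyEtale.of_isLocalization (nonZeroDivisors R)
  simp [derivFraction, KaehlerDifferential.tensorKaehlerEquivOfFormallyEtale_symm_D_algebraMap]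

theorem derivation_fraction_ext {d e : Derivation K (FractionRing R) (FractionRing R)}
    (h : ∀ a : R, d (algebraMap R (FractionRing R) a) = e (algebraMap R (FractionRing R) a)) :
    d = e := by
  ext q
  obtain ⟨⟨a, s⟩, hs⟩ := IsLocalization.surj (nonZeroDivisors R) q
  have hu := IsLocalization.map_units (FractionRing R) s
  have h1 : d (q * algebraMap R (FractionRing R) s) = e (q * algebraMap R (FractionRing R) s) := by
    rw [hs]; exact h a
  rw [Derivation.leibniz, Derivation.leibniz, h] at h1
  exact hu.mul_left_cancel (add_left_cancel h1)

/-- The bracket extended to the total ring of fractions by Leibniz's rule. -/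
def fractionBracket (D : Biderivation K R) : Biderivation K (FractionRing R) :=
  let T : Derivation K R R →ₗ[R] Derivation K (FractionRing R) (FractionRing R) :=
    { toFun := fun d => derivFraction ((Algebra.linearMap R (FractionRing R)).compDer d)
      map_add' := fun d e => derivation_fraction_ext fun a => by
        simp [derivFraction_algebraMap]
      map_smul' := fun r d => derivation_fraction_ext fun a => by
        simp [derivFraction_algebraMap, Algebra.smul_def] }
  derivFraction (T.compDer D)

@[simp]
theorem fractionBracket_algebraMap (D : Biderivation K R) (a b : R) :
    fractionBracket D (algebraMap R (FractionRing R) a) (algebraMap R (FractionRing R) b) =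
      algebraMap R (FractionRing R) (D a b) := by
  simp [fractionBracket, derivFraction_algebraMap]

/-- Compatibility with an ideal only has to be checked on generators. -/
theorem compatible_span (D : Biderivation K R) (hD : ∀ a b, D a b = -D b a) (S G : Set R)
    (hG : Algebra.adjoin K G = ⊤) (h : ∀ g ∈ G, ∀ s ∈ S, D g s ∈ Ideal.span S) :
    Compatible D (Ideal.span S) := by
  have h1 : ∀ s ∈ S, ∀ a, D a s ∈ Ideal.span S := by
    intro s hs a
    have ha : a ∈ Algebra.adjoin K G := by rw [hG]; trivial
    induction ha using Algebra.adjoin_induction with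
    | mem g hg => exact h g hg s hs
    | algebraMap r => simp
    | add x y _ _ hx hy => simpa using add_mem hx hy
    | mul x y _ _ hx hy =>
      simpa using add_mem (Ideal.mul_mem_left _ x hy) (Ideal.mul_mem_left _ y hx)
  have h2 : ∀ a, ∀ b ∈ Ideal.span S, D a b ∈ Ideal.span S := by
    intro a b hb
    induction hb using Submodule.span_induction with
    | mem s hs => exact h1 s hs a
    | zero => simp
    | add x y _ _ hx hy => simpa using add_mem hx hy
    | smul r x hx hx' =>
      simpa using add_mem (Ideal.mul_mem_left _ r hx') (Ideal.mul_mem_right _ _ hx)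
  exact ⟨fun a ha b => by rw [hD]; exact neg_mem (h2 b a ha), h2⟩

theorem polyBracket_X_antisymm {σ : Type*} (c : σ → σ → MvPolynomial σ K)
    (hc : ∀ p q, c p q = -c q p) (p : σ) (g : MvPolynomial σ K) :
    polyBracket c (X p) g = -polyBracket c g (X p) := by
  induction g using MvPolynomial.induction_on with
  | C r => simp
  | add g g' h h' => simp only [map_add, Derivation.add_apply, h, h']; ring
  | mul_X g q h =>
    simp only [Derivation.leibniz, Derivation.add_apply, Derivation.smul_apply, h,
      polyBracket_X, hc p q, smul_eq_mul]
    ring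

theorem polyBracket_antisymm {σ : Type*} (c : σ → σ → MvPolynomial σ K)
    (hc : ∀ p q, c p q = -c q p) (f g : MvPolynomial σ K) :
    polyBracket c f g = -polyBracket c g f := by
  induction f using MvPolynomial.induction_on with
  | C r => simp
  | add f f' h h' => simp only [map_add, Derivation.add_apply, h, h']; ring
  | mul_X f p h =>
    simp only [Derivation.leibniz, Derivation.add_apply, Derivation.smul_apply, h,
      polyBracket_X_antisymm c hc p g, smul_eq_mul]
    ring

theorem derivation_prod {ι : Type*} [DecidableEq ι] (d : Derivation K R R) (s : Finset ι)
    (f : ι → R) : d (∏ i ∈ s, f i) = ∑ i ∈ s, (∏ j ∈ s.erase i, f j) * d (f i) := by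
  induction s using Finset.induction_on with
  | empty => simp
  | insert a s ha ih =>
    rw [Finset.prod_insert ha, Derivation.leibniz, Finset.sum_insert ha, Finset.erase_insert ha, ih,
      add_comm, smul_eq_mul, smul_eq_mul, Finset.mul_sum]
    congr 1
    refine Finset.sum_congr rfl fun i hi => ?_
    rw [Finset.erase_insert_of_ne (by rintro rfl; exact ha hi), Finset.prod_insert
      (fun h => ha (Finset.mem_of_mem_erase h)), mul_assoc]

theorem derivation_det {ι : Type*} [DecidableEq ι] [Fintype ι] (d : Derivation K R R)
    (M : Matrix ι ι R) : d M.det = ∑ j, ∑ i, M.adjugate j i * d (M i j) := by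
  have h : ∀ j, ∑ i, M.adjugate j i * d (M i j) = (M.updateCol j fun i => d (M i j)).det := by
    intro j
    rw [← Matrix.cramer_apply, Matrix.cramer_eq_adjugate_mulVec]
    rfl
  simp_rw [h, Matrix.det_apply', map_sum]
  rw [Finset.sum_comm]
  refine Finset.sum_congr rfl fun σ _ => ?_
  rw [← zsmul_eq_mul, map_zsmul, derivation_prod, zsmul_eq_mul, Finset.mul_sum]
  refine Finset.sum_congr rfl fun j _ => ?_
  congr 1
  rw [← Finset.prod_erase_mul _ _ (Finset.mem_univ j)]
  congr 1
  · refine Finset.prod_congr rfl fun k hk => ?_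
    rw [Matrix.updateCol_ne (Finset.ne_of_mem_erase hk)]
  · simp

theorem derivation_det_mem {ι : Type*} [DecidableEq ι] [Fintype ι] (d : Derivation K R R)
    (I : Ideal R) (M : Matrix ι ι R) (u w f g : ι → R) (c e : R)
    (hd : ∀ i j, d (M i j) = (f j - g i) * (c * (w j * u i) + e * M i j))
    (hM : M.det ∈ I) (hu : ∀ j, (M.updateCol j u).det ∈ I) (hw : ∀ i, (M.updateRow i w).det ∈ I) :
    d M.det ∈ I := by
  have h1 : ∀ j, ∑ i, M.adjugate j i * u i = (M.updateCol j u).det := by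
    intro j
    rw [← Matrix.cramer_apply, Matrix.cramer_eq_adjugate_mulVec]
    rfl
  have h2 : ∀ i, ∑ j, M.adjugate j i * w j = (M.updateRow i w).det := by
    intro i
    rw [← Matrix.cramer_transpose_apply, Matrix.cramer_eq_adjugate_mulVec,
      ← Matrix.adjugate_transpose]
    rfl
  have h3 : ∀ j, ∑ i, M.adjugate j i * M i j = M.det := by
    intro j
    have := congrFun (congrFun (Matrix.adjugate_mul M) j) j
    simpa [Matrix.mul_apply] using this
  have h4 : ∀ i, ∑ j, M.adjugate j i * M i j = M.det := by
    intro i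
    have := congrFun (congrFun (Matrix.mul_adjugate M) i) i
    simp only [Matrix.mul_apply, Matrix.smul_apply, Matrix.one_apply_eq, smul_eq_mul,
      mul_one] at this
    rw [← this]
    exact Finset.sum_congr rfl fun _ _ => mul_comm _ _
  have h5 : d M.det = c * (∑ j, f j * w j * (M.updateCol j u).det)
      - c * (∑ i, g i * u i * (M.updateRow i w).det)
      + e * (∑ j, f j * M.det) - e * (∑ i, g i * M.det) := by
    rw [derivation_det]
    have e1 : ∑ i, g i * u i * (M.updateRow i w).det
        = ∑ j, ∑ i, g i * u i * (M.adjugate j i * w j) := by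
      rw [Finset.sum_comm]; simp_rw [← h2, Finset.mul_sum]
    have e2 : ∑ i, g i * M.det = ∑ j, ∑ i, g i * (M.adjugate j i * M i j) := by
      rw [Finset.sum_comm]; simp_rw [← Finset.mul_sum, h4]
    have e3 : ∑ j, f j * M.det = ∑ j, ∑ i, f j * (M.adjugate j i * M i j) := by
      simp_rw [← Finset.mul_sum, h3]
    rw [e1, e2, e3]
    simp_rw [← h1, Finset.mul_sum, ← Finset.sum_sub_distrib, ← Finset.sum_add_distrib,
      ← Finset.sum_sub_distrib]
    refine Finset.sum_congr rfl fun j _ => Finset.sum_congr rfl fun i _ => ?_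
    rw [hd]
    ring
  rw [h5]
  refine sub_mem (add_mem (sub_mem ?_ ?_) ?_) ?_ <;> refine Ideal.mul_mem_left _ _ (sum_mem ?_)
  · exact fun j _ => Ideal.mul_mem_left _ _ (hu j)
  · exact fun j _ => Ideal.mul_mem_left _ _ (hw j)
  · exact fun j _ => Ideal.mul_mem_left _ _ hM
  · exact fun j _ => Ideal.mul_mem_left _ _ hM

end Generic
section Swap

/-! ### The swapping algebra

A finite set of points on the circle is cut open at a point outside it; the set then becomes
linearly ordered, increasing in the anticlockwise direction. -/

variable {P : Type*} [LinearOrder P]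

/-- The signature of `a - b`. -/
def signature (a b : P) : ℚ := if a < b then -1 else if a = b then 0 else 1

/-- The linking number of the ordered pairs `(r, x)` and `(s, y)`. -/
def linking (r x s y : P) : ℚ :=
  1 / 2 * (signature r x * signature r y * signature y x
    - signature r x * signature r s * signature s x)

theorem signature_triple (a b c : P) : signature a b * signature a c * signature c b =
    signature b a + signature c b + signature a c := by
  simp only [signature]
  split_ifs <;> first | (exfalso; order) | norm_num

theorem signature_antisymm (a b : P) : signature a b = -signature b a := by
  simp only [signature]
  rcases lt_trichotomy a b with h | h | h
  · simp [h, h.not_gt, h.ne']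
  · simp [h]
  · simp [h, h.not_gt, h.ne']

theorem linking_antisymm (r x s y : P) : linking r x s y = -linking s y r x := by
  simp only [linking, signature_triple]
  rw [signature_antisymm x r, signature_antisymm y x, signature_antisymm y s,
    signature_antisymm s x, signature_antisymm r s, signature_antisymm r y]
  ring

variable (K : Type*) [Field K] [CharZero K] (P)

/-- The ideal generated by the variables `xx`. -/
def diagonalIdeal : Ideal (MvPolynomial (P × P) K) :=
  Ideal.span (Set.range fun x : P => X (x, x))

/-- The ring `𝒵(P)`: polynomials in the ordered pairs of points, with `xx = 0`. -/
def SwapRing := MvPolynomial (P × P) K ⧸ diagonalIdeal P K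

instance : CommRing (SwapRing P K) :=
  inferInstanceAs (CommRing (MvPolynomial (P × P) K ⧸ diagonalIdeal P K))

instance : Algebra K (SwapRing P K) :=
  inferInstanceAs (Algebra K (MvPolynomial (P × P) K ⧸ diagonalIdeal P K))

/-- The projection from polynomials in the ordered pairs to `𝒵(P)`. -/
def swapMk : MvPolynomial (P × P) K →ₐ[K] SwapRing P K :=
  Ideal.Quotient.mkₐ K (diagonalIdeal P K)

theorem swapMk_surjective : Function.Surjective (swapMk P K) :=
  Ideal.Quotient.mkₐ_surjective K (diagonalIdeal P K)

variable {P}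

/-- The class of the ordered pair `xy` in `𝒵(P)`. -/
def pair (x y : P) : SwapRing P K := swapMk P K (X (x, y))

/-- The determinant `Δ((x₁, …, x_k), (y₁, …, y_k)) = det (x_i y_j)` in `𝒵(P)`. -/
def swapDet {k : ℕ} (x y : Fin k → P) : SwapRing P K :=
  Matrix.det (Matrix.of fun i j => pair K (x i) (y j))

variable (P)

/-- The ideal `R_n(P)` generated by all `(n + 1) × (n + 1)` determinants. -/
def rankIdeal (n : ℕ) : Ideal (SwapRing P K) :=
  Ideal.span {d | ∃ x y : Fin (n + 1) → P, d = swapDet K x y}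

/-- The rank `n` swapping ring `𝒵_n(P)`. -/
def RankRing (n : ℕ) := SwapRing P K ⧸ rankIdeal P K n

instance (n : ℕ) : CommRing (RankRing P K n) :=
  inferInstanceAs (CommRing (SwapRing P K ⧸ rankIdeal P K n))

instance (n : ℕ) : Algebra K (RankRing P K n) :=
  inferInstanceAs (Algebra K (SwapRing P K ⧸ rankIdeal P K n))

/-- The projection from `𝒵(P)` to `𝒵_n(P)`. -/
def rankMk (n : ℕ) : SwapRing P K →ₐ[K] RankRing P K n :=
  Ideal.Quotient.mkₐ K (rankIdeal P K n)

/-- The total fraction ring `𝒬_n(P)` of `𝒵_n(P)`. -/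
abbrev RankFraction (n : ℕ) := FractionRing (RankRing P K n)

variable {K}

/-- The `(c₁, c₂)`-swapping bracket on the polynomial ring in the ordered pairs of points. -/
def prePoisson (c₁ c₂ : K) : Biderivation K (MvPolynomial (P × P) K) :=
  polyBracket fun p q => C ((linking p.1 p.2 q.1 q.2 : ℚ) : K) *
    (C c₁ * (X (p.1, q.2) * X (q.1, p.2)) + C c₂ * (X p * X q))

theorem prePoisson_antisymm (c₁ c₂ : K) (f g : MvPolynomial (P × P) K) :
    prePoisson P c₁ c₂ f g = -prePoisson P c₁ c₂ g f := by
  refine polyBracket_antisymm _ (fun p q => ?_) f g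
  rw [linking_antisymm]
  push_cast
  rw [C_neg]
  ring

theorem compatible_diagonal (c₁ c₂ : K) :
    Compatible (prePoisson P c₁ c₂) (diagonalIdeal P K) := by
  refine compatible_span _ (prePoisson_antisymm P c₁ c₂) _ (Set.range X)
    MvPolynomial.adjoin_range_X ?_
  rintro _ ⟨p, rfl⟩ _ ⟨x, rfl⟩
  have : linking p.1 p.2 x x = 0 := by simp [linking]
  simp [prePoisson, this]

/-- The `(c₁, c₂)`-swapping bracket on `𝒵(P)`. -/
def swapBracket (c₁ c₂ : K) : Biderivation K (SwapRing P K) :=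
  quotientBracket (prePoisson P c₁ c₂) _ (compatible_diagonal P c₁ c₂)

theorem swapBracket_mk (c₁ c₂ : K) (f g : MvPolynomial (P × P) K) :
    swapBracket P c₁ c₂ (swapMk P K f) (swapMk P K g) = swapMk P K (prePoisson P c₁ c₂ f g) :=
  quotientBracket_mk _ _ _ f g

variable {P} in
theorem swapBracket_pair (c₁ c₂ : K) (r x s y : P) :
    swapBracket P c₁ c₂ (pair K r x) (pair K s y) =
      algebraMap K _ ((linking r x s y : ℚ) : K) *
        (algebraMap K _ c₁ * (pair K r y * pair K s x) +
          algebraMap K _ c₂ * (pair K r x * pair K s y)) := by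
  simp only [pair, swapBracket_mk, prePoisson, polyBracket_X, map_mul, map_add,
    ← MvPolynomial.algebraMap_eq, AlgHom.commutes]

theorem swapBracket_antisymm (c₁ c₂ : K) (f g : SwapRing P K) :
    swapBracket P c₁ c₂ f g = -swapBracket P c₁ c₂ g f := by
  obtain ⟨f, rfl⟩ := swapMk_surjective P K f
  obtain ⟨g, rfl⟩ := swapMk_surjective P K g
  simp only [swapBracket_mk, prePoisson_antisymm P c₁ c₂ f g, map_neg]

theorem adjoin_pair :
    Algebra.adjoin K (Set.range fun p : P × P => pair K p.1 p.2) = ⊤ := by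
  have h := congrArg (Subalgebra.map (swapMk P K))
    (MvPolynomial.adjoin_range_X (R := K) (σ := P × P))
  rw [AlgHom.map_adjoin, ← Set.range_comp, Algebra.map_top,
    (AlgHom.range_eq_top _).2 (swapMk_surjective P K)] at h
  exact h

/-- `R_n(P)` is a Poisson ideal. -/
theorem compatible_rank (n : ℕ) (c₁ c₂ : K) :
    Compatible (swapBracket P c₁ c₂) (rankIdeal P K n) := by
  refine compatible_span _ (swapBracket_antisymm P c₁ c₂) _ _ (adjoin_pair P) ?_
  rintro _ ⟨⟨a, b⟩, rfl⟩ _ ⟨x, y, rfl⟩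
  have hmem : ∀ x y : Fin (n + 1) → P, swapDet K x y ∈ rankIdeal P K n :=
    fun x y => Ideal.subset_span ⟨x, y, rfl⟩
  let h : P → SwapRing P K := fun p =>
    algebraMap K _ ((1 / 2 * (signature a b * signature a p * signature p b) : ℚ) : K)
  refine derivation_det_mem _ _ _ (fun i => pair K (x i) b) (fun j => pair K a (y j))
    (fun j => h (y j)) (fun i => h (x i)) (algebraMap K _ c₁)
    (algebraMap K _ c₂ * pair K a b) ?_ (hmem x y) ?_ ?_
  · intro i j
    simp only [Matrix.of_apply, swapBracket_pair, h]
    rw [← map_sub]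
    have : ((linking a b (x i) (y j) : ℚ) : K) =
        ((1 / 2 * (signature a b * signature a (y j) * signature (y j) b) : ℚ) : K) -
        ((1 / 2 * (signature a b * signature a (x i) * signature (x i) b) : ℚ) : K) := by
      simp only [linking]
      push_cast
      ring
    rw [this]
    ring
  · intro j
    have hm := hmem x (Function.update y j b)
    refine Eq.subst (motive := fun z => z ∈ rankIdeal P K n)
      (congrArg Matrix.det (Matrix.ext fun i k => ?_)) hm
    by_cases hk : k = j
    · subst hk; simp
    · simp [hk]
  · intro i
    have hm := hmem (Function.update x i a) y
    refine Eq.subst (motive := fun z => z ∈ rankIdeal P K n)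
      (congrArg Matrix.det (Matrix.ext fun k j => ?_)) hm
    by_cases hk : k = i
    · subst hk; simp
    · simp [hk]

/-- The `(c₁, c₂)`-swapping bracket on the rank `n` swapping ring `𝒵_n(P)`. -/
def rankBracket (n : ℕ) (c₁ c₂ : K) : Biderivation K (RankRing P K n) :=
  quotientBracket (swapBracket P c₁ c₂) _ (compatible_rank P n c₁ c₂)

theorem rankBracket_mk (n : ℕ) (c₁ c₂ : K) (f g : SwapRing P K) :
    rankBracket P n c₁ c₂ (rankMk P K n f) (rankMk P K n g) =
      rankMk P K n (swapBracket P c₁ c₂ f g) :=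
  quotientBracket_mk _ _ _ f g

/-- The `(c₁, c₂)`-swapping bracket on the rank `n` swapping fraction algebra `𝒬_n(P)`. -/
def rankFractionBracket (n : ℕ) (c₁ c₂ : K) : Biderivation K (RankFraction P K n) :=
  fractionBracket (rankBracket P n c₁ c₂)

variable {P} (K)

/-- The determinant `Δ((x₁, …, x_k), (y₁, …, y_k))` in `𝒵_n(P)`. -/
def rankDet (n : ℕ) {k : ℕ} (x y : Fin k → P) : RankRing P K n :=
  rankMk P K n (swapDet K x y)

/-- The determinant quotient
`E(x₁, …, x_k | t, y) = Δ((x₁, …, x_k, t), v) / Δ((x₁, …, x_k, y), v)` in `𝒬_n(P)`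
computed with the right side tuple `v`; meaningful when the denominator is not a zero divisor. -/
def detQuotient (n : ℕ) {k : ℕ} (x : Fin k → P) (t y : P) (v : Fin (k + 1) → P) :
    RankFraction P K n :=
  let Δ : P → RankFraction P K n := fun z =>
    algebraMap (RankRing P K n) _ (rankDet K n (Fin.snoc (α := fun _ => P) x z) v)
  Δ t * Ring.inverse (Δ y)

/-- The increasing enumeration of `I` with the element `i` omitted. -/
def omitPoint {n : ℕ} {I : Finset P} (hI : I.card = n) (i : {i // i ∈ I}) : Fin (n - 1) → P :=
  (I.erase i.1).orderEmbOfFin (by rw [Finset.card_erase_of_mem i.2, hI])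

/-! ### The bracket on a cell of the Grassmannian -/

/-- `a, b, c` are distinct and in anticlockwise cyclic order. -/
def Cyclic₃ (a b c : P) : Prop := (a < b ∧ b < c) ∨ (b < c ∧ c < a) ∨ (c < a ∧ a < b)

/-- `a, b, c, d` are distinct and in anticlockwise cyclic order. -/
def Cyclic₄ (a b c d : P) : Prop :=
  (a < b ∧ b < c ∧ c < d) ∨ (b < c ∧ c < d ∧ d < a) ∨
    (c < d ∧ d < a ∧ a < b) ∨ (d < a ∧ a < b ∧ b < c)

open Classical in
/-- The number `s₌(i, j, i', j')`. -/
def parallelNumber (i j i' j' : P) : ℚ :=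
  if Cyclic₄ i i' j' j then 1
  else if Cyclic₄ i' i j j' then -1
  else if (i = i' ∧ Cyclic₃ i j' j) ∨ (j' = j ∧ Cyclic₃ i i' j) then 1 / 2
  else if (i' = i ∧ Cyclic₃ i j j') ∨ (j = j' ∧ Cyclic₃ i' i j) then -1 / 2
  else 0

variable {K}

/-- The coordinate ring `K[m_{ij} : i ∈ I, j ∉ I]` of the cell of the Grassmannian on which the
Plücker coordinate `x_I` does not vanish; `m_{ij}` is the coordinate `x_{I(i → j)} / x_I`. -/
abbrev CellRing (K : Type*) [Field K] (I : Finset P) :=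
  MvPolynomial ({i // i ∈ I} × {j // j ∉ I}) K

/-- The bracket `{·, ·}_{B_{α, β}}` on the coordinate ring of the cell. -/
def cellBracket (I : Finset P) (α β : K) : Biderivation K (CellRing K I) :=
  polyBracket fun p q =>
    C ((α - β) * ((parallelNumber p.1.1 p.2.1 q.1.1 q.2.1 : ℚ) : K)) *
        (X (p.1, q.2) * X (q.1, p.2)) +
      C ((α + β) * ((linking p.1.1 p.2.1 q.1.1 q.2.1 : ℚ) : K)) * (X p * X q)

end Swap

end

end Swapping

/-!
The rank `n` swapping ring is, in characteristic zero, the ring of pairings `⟨a_x, b_y⟩` of vectors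
and covectors of `K ^ n`, indexed by the points, with `⟨a_x, b_x⟩ = 0`. Everything follows from this
and from linear algebra in its total fraction ring.

*The ring of pairings.* Substituting the pairings for the pairs of points maps the swapping ring to
`K[a, b] / (⟨a_p, b_p⟩)`, and this map is injective for two reasons. First, the relations among all
pairings are generated by the `(n + 1)`-minors (`mem_minorIdeal_of_pairingHom_eq_zero`). Modulo the
minors, every polynomial is a combination of monomials not divisible by the diagonal term of an
`(n + 1)`-minor. The rows and columns of such a monomial can be coloured with `n` colours so that in
each colour the columns weakly decrease as the rows increase; the corresponding term of the substituted
monomial recovers the monomial, up to others with larger corner counts. Second, the subalgebra of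
pairings is a direct summand in the sense that an element of the ideal generated by the `⟨a_p, b_p⟩`
that lies in the subalgebra lies in the ideal that they generate there
(`exists_pairingHom_eq_of_mem_span_rat`). Over `ℚ` this uses the Fischer form, which is positive
definite: the adjoint of multiplication by a pairing is a second-order operator that preserves the
subalgebra. Coefficients in `K` are reduced to rational ones by a basis of `K` over `ℚ`. Finally, the
ideal generated by the `⟨a_p, b_p⟩` is prime for `n ≥ 2` (`isPrime_span_genericPairing`), so the
`n`-minors with distinct rows and distinct columns are not zero divisors
(`rankDet_mem_nonZeroDivisors`).

*The map.* In the total fraction ring, the row of each point is a combination of the rows of the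
points of `I` (`fracPair_eq_sum`). By Cramer's rule the coefficients are the determinant quotients
`E` (`fracCoord_eq_detQuotient`), whatever columns are used. They are algebraically independent
because the swapping ring specializes to the matrices in the cell, for a suitable choice of
covectors (`aeval_fracCoord_injective`).

*The brackets.* The linking number is half of a sum of four signatures around a quadrilateral
(`linking_eq_half_sum`), and so is the parallel number (`parallelNumber_eq_half_sum`). Applying the
derivation `{cd, ·}` to the expansion of a row in the basis `I` gives the bracket of a pair and a
coordinate, since the coordinates with respect to a basis are unique; repeating this in the other
argument gives the bracket of two coordinates (`rankFractionBracket_fracCoord`), which is that of the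
cell.
-/

namespace Swapping

open MvPolynomial

/-! ### The incidence ideal is prime -/

section Incidence

variable {R : Type*} [CommRing R]

/-- The pairing `∑ₖ uₖ wₖ` of the row `p` of vectors with the row `q` of covectors: the variables
`(p, inl k)` are the coordinates of the vectors and `(q, inr k)` those of the covectors. -/
noncomputable def genericPairing (R : Type*) [CommRing R] {P κ : Type*} [Fintype κ] (p q : P) :
    MvPolynomial (P × (κ ⊕ κ)) R :=
  ∑ k, X (p, Sum.inl k) * X (q, Sum.inr k)

/-- A nondegenerate split quadric in at least four variables over a domain is integral. The quotient
embeds in the field where the variable `inr i₀` is solved from the equation; this uses that the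
coefficient of that variable is a prime not dividing the form. -/
theorem isPrime_span_splitForm [IsDomain R] {κ : Type*} [Fintype κ] [Nontrivial κ] :
    (Ideal.span {(∑ k, X (Sum.inl k) * X (Sum.inr k) : MvPolynomial (κ ⊕ κ) R)}).IsPrime := by
  classical
  obtain ⟨i₀, i₁, h01⟩ := exists_pair_ne κ
  set q : MvPolynomial (κ ⊕ κ) R := ∑ k, X (Sum.inl k) * X (Sum.inr k) with hq
  set p : MvPolynomial (κ ⊕ κ) R := X (Sum.inl i₀) with hp
  set c : MvPolynomial (κ ⊕ κ) R := ∑ k ∈ Finset.univ.erase i₀, X (Sum.inl k) * X (Sum.inr k)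
    with hc
  have hqc : q = p * X (Sum.inr i₀) + c :=
    (Finset.add_sum_erase Finset.univ (fun k => X (Sum.inl k) * X (Sum.inr k))
      (Finset.mem_univ i₀)).symm
  have hpp : Prime p := X_prime
  have hpq : ¬ p ∣ q := by
    rintro ⟨g, hg⟩
    have := congrArg (eval fun s => if s = Sum.inl i₁ ∨ s = Sum.inr i₁ then (1 : R) else 0) hg
    rw [hq, hp, map_sum, Finset.sum_eq_single i₁] at this
    · simp [h01] at this
    · intro k _ hk
      simp [hk]
    · simp
  let F := FractionRing (MvPolynomial (κ ⊕ κ) R)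
  let ι : MvPolynomial (κ ⊕ κ) R →+* F := algebraMap _ F
  have hι : Function.Injective ι := IsFractionRing.injective _ F
  have hp0 : ι p ≠ 0 := fun h => hpp.ne_zero (hι (by rw [h, map_zero]))
  obtain ⟨y, hy⟩ : ∃ y, ι p * y = -ι c := ⟨(ι p)⁻¹ * -ι c, mul_inv_cancel_left₀ hp0 _⟩
  let ψ : MvPolynomial (κ ⊕ κ) R →+* F := eval₂Hom (ι.comp C) fun s =>
    if s = Sum.inr i₀ then y else ι (X s)
  have hψX : ∀ s, s ≠ Sum.inr i₀ → ψ (X s) = ι (X s) := fun s hs => by simp [ψ, hs]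
  have hψ0 : ψ (X (Sum.inr i₀)) = y := by simp [ψ]
  have hψq : ψ q = 0 := by
    have h1 : ψ c = ι c := by
      simp only [hc, map_sum, map_mul]
      refine Finset.sum_congr rfl fun k hk => ?_
      rw [hψX _ (by simp), hψX _ (by simpa using Finset.ne_of_mem_erase hk)]
    rw [hqc, map_add, map_mul, h1, hψ0, hψX _ (by simp), hy]
    ring
  -- Modulo the form, a power of the leading coefficient eliminates the variable `inr i₀`.
  have key : ∀ f, ∃ (N : ℕ) (r : MvPolynomial (κ ⊕ κ) R), q ∣ p ^ N * f - r ∧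
      ι p ^ N * ψ f = ι r := by
    intro f
    induction f using MvPolynomial.induction_on with
    | C a => exact ⟨0, C a, by simp, by simp [ψ]⟩
    | add f g hf hg =>
      obtain ⟨N, r, ⟨x, hx⟩, h⟩ := hf
      obtain ⟨M, s, ⟨y, hy⟩, h'⟩ := hg
      refine ⟨N + M, p ^ M * r + p ^ N * s, ⟨p ^ M * x + p ^ N * y, ?_⟩, ?_⟩
      · linear_combination p ^ M * hx + p ^ N * hy
      · simp only [map_add, map_mul, map_pow]
        linear_combination ι p ^ M * h + ι p ^ N * h'
    | mul_X f s hf =>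
      obtain ⟨N, r, ⟨x, hx⟩, h⟩ := hf
      by_cases hs : s = Sum.inr i₀
      · subst hs
        refine ⟨N + 1, -(r * c), ⟨p * x * X (Sum.inr i₀) + r, ?_⟩, ?_⟩
        · linear_combination p * X (Sum.inr i₀) * hx - r * hqc
        · simp only [map_mul, map_neg, hψ0]
          linear_combination ι p * y * h + ι r * hy
      · refine ⟨N, r * X s, ⟨x * X s, ?_⟩, ?_⟩
        · linear_combination X s * hx
        · rw [map_mul, map_mul, hψX s hs]
          linear_combination ι (X s) * h
  have hker : RingHom.ker ψ = Ideal.span {q} := by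
    refine le_antisymm (fun f hf => ?_) ?_
    · obtain ⟨N, r, hd, h⟩ := key f
      rw [(RingHom.mem_ker).1 hf, mul_zero] at h
      have hr : r = 0 := hι (by rw [← h, map_zero])
      rw [hr, sub_zero] at hd
      obtain ⟨g, hg⟩ := hd
      obtain ⟨g', rfl⟩ := hpp.pow_dvd_of_dvd_mul_left N hpq ⟨f, hg.symm⟩
      rw [Ideal.mem_span_singleton]
      refine ⟨g', mul_left_cancel₀ (pow_ne_zero N hpp.ne_zero) ?_⟩
      linear_combination hg
    · rw [Ideal.span_singleton_le_iff_mem]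
      exact hψq
  rw [← hker]
  exact RingHom.ker_isPrime ψ

/-- Adjoining a new vector and covector with zero pairing keeps a prime ideal prime. -/
theorem isPrime_map_C_sup_span_splitForm {κ : Type*} [Fintype κ] [Nontrivial κ] (I : Ideal R)
    [I.IsPrime] :
    (I.map (C : R →+* MvPolynomial (κ ⊕ κ) R) ⊔
      Ideal.span {∑ k, X (Sum.inl k) * X (Sum.inr k)}).IsPrime := by
  let f : MvPolynomial (κ ⊕ κ) R →+* MvPolynomial (κ ⊕ κ) (R ⧸ I) :=
    MvPolynomial.map (Ideal.Quotient.mk I)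
  have hf : Function.Surjective f := MvPolynomial.map_surjective _ Ideal.Quotient.mk_surjective
  have hJ : I.map (C : R →+* MvPolynomial (κ ⊕ κ) R) ⊔
      Ideal.span {∑ k, X (Sum.inl k) * X (Sum.inr k)} =
      Ideal.comap f (Ideal.span {∑ k, X (Sum.inl k) * X (Sum.inr k)}) := by
    have hq : f (∑ k, X (Sum.inl k) * X (Sum.inr k)) = ∑ k, X (Sum.inl k) * X (Sum.inr k) := by
      simp [f]
    rw [← hq, ← Set.image_singleton (f := f), ← Ideal.map_span, Ideal.comap_map_of_surjective f hf,
      ← RingHom.ker_eq_comap_bot, MvPolynomial.ker_map, Ideal.mk_ker, sup_comm]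
  rw [hJ]
  have := isPrime_span_splitForm (R := R ⧸ I) (κ := κ)
  infer_instance

/-- The ideal generated by the equations of incidence `⟨a_p, b_p⟩ = 0`, one for each `p`, is prime
when the vectors have at least two coordinates. -/
theorem isPrime_span_genericPairing [IsDomain R] {κ : Type*} [Fintype κ] [Nontrivial κ]
    (P : Type*) [Fintype P] :
    (Ideal.span (Set.range fun p : P => genericPairing R (κ := κ) p p)).IsPrime := by
  refine Fintype.induction_empty_option (P := fun P _ => (Ideal.span (Set.range fun p : P =>
    genericPairing R (κ := κ) p p)).IsPrime) ?_ ?_ ?_ P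
  · intro P Q _ e h
    let E := renameEquiv R (Equiv.prodCongr e (Equiv.refl (κ ⊕ κ)))
    have := Ideal.map_isPrime_of_equiv E
      (I := Ideal.span (Set.range fun p : P => genericPairing R (κ := κ) p p))
    rw [Ideal.map_span, ← Set.range_comp] at this
    convert this using 2
    rw [← e.surjective.range_comp]
    congr 1
    ext1 p
    simp [E, genericPairing]
  · rw [Set.range_eq_empty, Ideal.span_empty]
    exact Ideal.isPrime_bot
  · intro P _ h
    let eq : (κ ⊕ κ) ⊕ (P × (κ ⊕ κ)) ≃ Option P × (κ ⊕ κ) :=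
      { toFun := Sum.elim (fun t => (none, t)) fun x => (some x.1, x.2)
        invFun := fun x => x.1.elim (Sum.inl x.2) fun p => Sum.inr (p, x.2)
        left_inv := by rintro (t | ⟨p, t⟩) <;> rfl
        right_inv := by rintro ⟨_ | p, t⟩ <;> rfl }
    let E : MvPolynomial (κ ⊕ κ) (MvPolynomial (P × (κ ⊕ κ)) R) ≃ₐ[R]
        MvPolynomial (Option P × (κ ⊕ κ)) R :=
      (sumAlgEquiv R _ _).symm.trans (renameEquiv R eq)
    have hE₀ : ∀ t, E (X t) = X (none, t) := fun t => by
      simp only [E, AlgEquiv.trans_apply]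
      rw [show (sumAlgEquiv R (κ ⊕ κ) (P × (κ ⊕ κ))).symm (X t) = X (Sum.inl t) from
        (AlgEquiv.symm_apply_eq _).2 (by simp)]
      simp [eq]
    have hE₁ : ∀ p t, E (C (X (p, t))) = X (some p, t) := fun p t => by
      simp only [E, AlgEquiv.trans_apply]
      rw [show (sumAlgEquiv R (κ ⊕ κ) (P × (κ ⊕ κ))).symm (C (X (p, t))) = X (Sum.inr (p, t)) from
        (AlgEquiv.symm_apply_eq _).2 (by simp)]
      simp [eq]
    have hp := isPrime_map_C_sup_span_splitForm (κ := κ)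
      (Ideal.span (Set.range fun p : P => genericPairing R (κ := κ) p p))
    have hp' := @Ideal.map_isPrime_of_equiv _ _ _ _ _ _ _ E _ hp
    rw [Ideal.map_sup, Ideal.map_span, Ideal.map_span, Ideal.map_span, ← Ideal.span_union] at hp'
    convert hp' using 2
    rw [← Set.range_comp, ← Set.range_comp, Set.image_singleton]
    ext y
    simp only [Set.mem_union, Set.mem_singleton_iff, Set.mem_range, Option.exists,
      Function.comp_apply, genericPairing, map_sum, map_mul, hE₀, hE₁, eq_comm, or_comm]

end Incidence

/-! ### Relations among the pairings of vectors and covectors -/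

/-- A finite set without chains of `n + 1` elements for a transitive relation can be coloured with
`n` colours such that related elements have different colours. -/
theorem exists_coloring_of_no_chain {α : Type*} (r : α → α → Prop) [IsTrans α r] (n : ℕ)
    (S : Finset α)
    (h : ¬ ∃ z : Fin (n + 1) → α, (∀ t, z t ∈ S) ∧ ∀ a b, a < b → r (z a) (z b)) :
    ∃ col : α → ℕ, (∀ x ∈ S, col x < n) ∧ ∀ x ∈ S, ∀ y ∈ S, r x y → col x ≠ col y := by
  classical
  induction n generalizing S with
  | zero =>
    have hS : ∀ x, x ∉ S := fun x hx => h ⟨fun _ => x, fun _ => hx, fun a b hab => by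
      have : a = b := Subsingleton.elim (α := Fin 1) a b
      exact absurd hab (this ▸ lt_irrefl a)⟩
    exact ⟨fun _ => 0, fun x hx => absurd hx (hS x), fun x hx => absurd hx (hS x)⟩
  | succ n ih =>
    -- The minimal elements get a colour of their own.
    obtain ⟨col, h1, h2⟩ := ih (S.filter fun x => ∃ y ∈ S, r y x) (by
      rintro ⟨z, hz, hr⟩
      obtain ⟨y, hy, hyz⟩ := (Finset.mem_filter.1 (hz 0)).2
      refine h ⟨Fin.cons y z, fun t => ?_, fun a b hab => ?_⟩
      · refine Fin.cases ?_ (fun t => ?_) t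
        · simpa using hy
        · simpa using (Finset.mem_filter.1 (hz t)).1
      · obtain ⟨b, rfl⟩ := Fin.exists_succ_eq.2 (Fin.ne_zero_of_lt hab)
        have h0b : r y (z b) := by
          rcases (Fin.zero_le b).eq_or_lt with hb | hb
          · rwa [← hb]
          · exact _root_.trans hyz (hr _ _ hb)
        refine Fin.cases (fun _ => ?_) (fun a hab => ?_) a hab
        · simpa using h0b
        · simpa using hr _ _ (Fin.succ_lt_succ_iff.1 hab))
    refine ⟨fun x => if ∃ y ∈ S, r y x then col x else n, fun x hx => ?_, fun x hx y hy hxy => ?_⟩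
    · dsimp only
      split_ifs with hc
      · exact (h1 x (Finset.mem_filter.2 ⟨hx, hc⟩)).trans (Nat.lt_succ_self n)
      · exact Nat.lt_succ_self n
    · have hy' : ∃ z ∈ S, r z y := ⟨x, hx, hxy⟩
      dsimp only
      rw [if_pos hy']
      split_ifs with hc
      · exact h2 x (Finset.mem_filter.2 ⟨hx, hc⟩) y (Finset.mem_filter.2 ⟨hy, hy'⟩) hxy
      · exact (h1 y (Finset.mem_filter.2 ⟨hy, hy'⟩)).ne'

/-- A matrix of size `n + 1` that factors through a free module of rank `n` is singular. -/
theorem det_mul_eq_zero {R : Type*} [CommRing R] {n : ℕ} (U : Matrix (Fin (n + 1)) (Fin n) R)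
    (V : Matrix (Fin n) (Fin (n + 1)) R) : (U * V).det = 0 := by
  -- Pad the factors with zeros to square matrices.
  let U' : Matrix (Fin (n + 1)) (Fin (n + 1)) R := Matrix.of fun a => Fin.cons 0 (U a)
  let V' : Matrix (Fin (n + 1)) (Fin (n + 1)) R := Matrix.of (Fin.cons 0 V)
  have h : U * V = U' * V' := by
    ext a b
    have hV : ∀ x : Fin n, (Fin.cons 0 V : Fin (n + 1) → Fin (n + 1) → R) x.succ = V x :=
      fun x => rfl
    simp [Matrix.mul_apply, Fin.sum_univ_succ, U', V', hV]
  rw [h, Matrix.det_mul, Matrix.det_eq_zero_of_column_eq_zero 0 fun a => by simp [U'], zero_mul]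

section Minors

variable (K : Type*) [Field K] {P : Type*}

/-- The substitution of the pairing of the `x`-th vector with the `y`-th covector of `K ^ n` for the
variable `xy`. -/
noncomputable def pairingHom (P : Type*) (n : ℕ) :
    MvPolynomial (P × P) K →ₐ[K] MvPolynomial (P × (Fin n ⊕ Fin n)) K :=
  aeval fun p => genericPairing K p.1 p.2

/-- The ideal of the `(n + 1) × (n + 1)` minors of the generic matrix. -/
noncomputable def minorIdeal (P : Type*) (n : ℕ) : Ideal (MvPolynomial (P × P) K) :=
  Ideal.span {f | ∃ x y : Fin (n + 1) → P, f = (Matrix.of fun a b => X (x a, y b)).det}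

/-- A monomial in the entries of the generic matrix, given by its exponents, is standard when it is
not divisible by the diagonal term of an `(n + 1) × (n + 1)` minor. -/
def IsStandard [LT P] (n : ℕ) (s : P × P →₀ ℕ) : Prop :=
  ¬ ∃ z : Fin (n + 1) → P × P, (∀ t, z t ∈ s.support) ∧
    ∀ a b, a < b → (z a).1 < (z b).1 ∧ (z a).2 < (z b).2

variable {K}

/-- Straightening: the diagonal term of a minor is, modulo the minor, a combination of the other
terms, and for these the sum of the products of the two indices is smaller by the rearrangement
inequality. -/
theorem monomial_mem_minorIdeal_sup_span_standard (m n : ℕ) (s : Fin m × Fin m →₀ ℕ) :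
    (monomial s 1 : MvPolynomial (Fin m × Fin m) K) ∈
      (minorIdeal K (Fin m) n).restrictScalars K ⊔
        Submodule.span K ((fun s => monomial s 1) '' {s | IsStandard n s}) := by
  classical
  let wt : (Fin m × Fin m →₀ ℕ) →+ ℕ := Finsupp.weight fun x => x.1.val * x.2.val
  induction hw : wt s using Nat.strong_induction_on generalizing s with
  | _ w ih =>
  by_cases hs : IsStandard n s
  · exact Submodule.mem_sup_right (Submodule.subset_span ⟨s, hs, rfl⟩)
  obtain ⟨z, hz, hlt⟩ := not_not.1 hs
  have hm1 : StrictMono fun a => (z a).1 := fun a b hab => (hlt a b hab).1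
  have hm2 : StrictMono fun a => (z a).2 := fun a b hab => (hlt a b hab).2
  have hinj : Function.Injective z := fun a b hab => hm1.injective (congrArg Prod.fst hab)
  have hle : ∑ t, Finsupp.single (z t) 1 ≤ s := by
    intro p
    rw [Finsupp.finsetSum_apply]
    simp only [Finsupp.single_apply]
    by_cases hp : ∃ t, z t = p
    · obtain ⟨t, rfl⟩ := hp
      simp only [hinj.eq_iff, Finset.sum_ite_eq', Finset.mem_univ, if_true]
      exact Nat.one_le_iff_ne_zero.2 (Finsupp.mem_support_iff.1 (hz t))
    · rw [Finset.sum_eq_zero fun t _ => if_neg fun h => hp ⟨t, h⟩]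
      exact Nat.zero_le _
  obtain ⟨s₀, rfl⟩ := exists_add_of_le hle
  let e : Equiv.Perm (Fin (n + 1)) → (Fin m × Fin m →₀ ℕ) := fun τ =>
    ∑ t, Finsupp.single ((z (τ t)).1, (z t).2) 1 + s₀
  have hdet : monomial s₀ 1 * (Matrix.of fun a b => X ((z a).1, (z b).2)).det =
      ∑ τ : Equiv.Perm (Fin (n + 1)),
        ((Equiv.Perm.sign τ : ℤ) : K) • (monomial (e τ) 1 : MvPolynomial (Fin m × Fin m) K) := by
    rw [Matrix.det_apply', Finset.mul_sum]
    refine Finset.sum_congr rfl fun τ _ => ?_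
    have : (monomial (e τ) 1 : MvPolynomial (Fin m × Fin m) K) =
        (∏ t, X ((z (τ t)).1, (z t).2)) * monomial s₀ 1 := by
      simp only [X, ← monomial_sum_one, monomial_mul, mul_one, e]
    rw [this, MvPolynomial.smul_eq_C_mul]
    simp only [Matrix.of_apply, map_intCast]
    ring
  have h1 : (monomial (e 1) 1 : MvPolynomial (Fin m × Fin m) K) =
      monomial s₀ 1 * (Matrix.of fun a b => X ((z a).1, (z b).2)).det -
        ∑ τ ∈ Finset.univ.erase 1, ((Equiv.Perm.sign τ : ℤ) : K) • monomial (e τ) 1 := by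
    rw [hdet, ← Finset.add_sum_erase _ _ (Finset.mem_univ 1)]
    simp
  change monomial (e 1) 1 ∈ _
  rw [h1]
  refine sub_mem (Submodule.mem_sup_left (Ideal.mul_mem_left _ _ (Ideal.subset_span
    ⟨_, _, rfl⟩))) (sum_mem fun τ hτ => Submodule.smul_mem _ _ (ih _ ?_ _ rfl))
  have hwe : ∀ τ, wt (e τ) = ∑ t, (z (τ t)).1.val * (z t).2.val + wt s₀ := by
    intro τ
    simp [wt, e, Finsupp.weight_single]
  rw [← hw]
  change wt (e τ) < wt (e 1)
  rw [hwe, hwe, add_lt_add_iff_right]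
  have hmono : Monovary (fun t => (z t).1.val) (fun t => (z t).2.val) := fun a b hab =>
    (hm1 (hm2.lt_iff_lt.1 hab)).le
  refine (hmono.sum_comp_perm_mul_lt_sum_mul_iff (σ := τ)).2 fun hv => ?_
  refine Finset.ne_of_mem_erase hτ ?_
  have hτm : StrictMono τ := by
    refine Monotone.strictMono_of_injective (fun a b hab => ?_) τ.injective
    rcases hab.eq_or_lt with rfl | hab
    · exact le_rfl
    · exact hm1.le_iff_le.1 (hv (hm2 hab))
  have hid : hτm.orderIsoOfSurjective τ τ.surjective = OrderIso.refl _ := Subsingleton.elim _ _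
  exact Equiv.ext fun t => congrArg (fun e : Fin (n + 1) ≃o Fin (n + 1) => e t) hid

/-- The exponents of the term of `∏ ⟨a_x, b_y⟩` (product over the factors `xy` of the monomial with
exponents `s`) in which the `κ t`-th summand is taken from the factor `t`. -/
noncomputable def termExponent {n : ℕ} [DecidableEq P] [Fintype P] (s : P × P →₀ ℕ)
    (κ : (Σ p : P × P, Fin (s p)) → Fin n) : P × (Fin n ⊕ Fin n) →₀ ℕ :=
  ∑ t, (Finsupp.single (t.1.1, Sum.inl (κ t)) 1 + Finsupp.single (t.1.2, Sum.inr (κ t)) 1)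

theorem pairingHom_monomial [DecidableEq P] [Fintype P] (n : ℕ) (s : P × P →₀ ℕ) :
    pairingHom K P n (monomial s 1) = ∑ κ, monomial (termExponent s κ) 1 := by
  rw [pairingHom, aeval_monomial, map_one, one_mul, Finsupp.prod_fintype _ _ (by simp)]
  have h1 : ∀ p : P × P, genericPairing K (κ := Fin n) p.1 p.2 ^ s p =
      ∏ _i : Fin (s p), genericPairing K p.1 p.2 := by simp
  simp_rw [h1]
  rw [← Fintype.prod_sigma' (fun (p : P × P) (_ : Fin (s p)) =>
    genericPairing K (κ := Fin n) p.1 p.2)]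
  simp only [genericPairing, X, monomial_mul, mul_one]
  rw [Finset.prod_univ_sum, Fintype.piFinset_univ]
  refine Finset.sum_congr rfl fun κ _ => ?_
  rw [termExponent, monomial_sum_one]

theorem coeff_pairingHom_monomial [DecidableEq P] [Fintype P] (n : ℕ) (s : P × P →₀ ℕ)
    (e : P × (Fin n ⊕ Fin n) →₀ ℕ) :
    coeff e (pairingHom K P n (monomial s 1)) =
      (Finset.univ.filter fun κ => termExponent s κ = e).card := by
  rw [pairingHom_monomial, coeff_sum]
  simp only [coeff_monomial, Finset.sum_boole]

/-- The number of factors of a monomial in a lower right corner of the generic matrix. -/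
def cornerCount {m : ℕ} (s : Fin m × Fin m →₀ ℕ) (p q : ℕ) : ℕ :=
  ∑ x, if p ≤ x.1.val ∧ q ≤ x.2.val then s x else 0

theorem cornerCount_injective {m : ℕ} :
    Function.Injective (cornerCount : (Fin m × Fin m →₀ ℕ) → ℕ → ℕ → ℕ) := by
  intro s s' h
  have key : ∀ (s : Fin m × Fin m →₀ ℕ) (x : Fin m × Fin m),
      s x + cornerCount s (x.1 + 1) x.2 + cornerCount s x.1 (x.2 + 1) =
        cornerCount s x.1 x.2 + cornerCount s (x.1 + 1) (x.2 + 1) := by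
    intro s x
    have h1 : s x = ∑ y, if y = x then s y else 0 := by simp
    rw [h1]
    simp only [cornerCount, ← Finset.sum_add_distrib]
    refine Finset.sum_congr rfl fun y _ => ?_
    have h2 : y = x ↔ y.1.val = x.1.val ∧ y.2.val = x.2.val := by
      rw [Prod.ext_iff, Fin.ext_iff, Fin.ext_iff]
    rw [if_congr h2 rfl rfl]
    split_ifs <;> omega
  ext x
  have h1 := key s x
  have h2 := key s' x
  rw [h] at h1
  omega

theorem cornerCount_eq_sum_card {m n : ℕ} (s : Fin m × Fin m →₀ ℕ)
    (κ : (Σ p : Fin m × Fin m, Fin (s p)) → Fin n) (p q : ℕ) :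
    cornerCount s p q = ∑ k, ((Finset.univ.filter fun t => κ t = k ∧ p ≤ t.1.1.val) ∩
      (Finset.univ.filter fun t => κ t = k ∧ q ≤ t.1.2.val)).card := by
  have h1 : cornerCount s p q = (Finset.univ.filter fun t : (Σ p : Fin m × Fin m, Fin (s p)) =>
      p ≤ t.1.1.val ∧ q ≤ t.1.2.val).card := by
    rw [Finset.card_filter, Fintype.sum_sigma]
    simp [cornerCount, apply_ite Finset.card]
  rw [h1, Finset.card_eq_sum_card_fiberwise (f := κ) (t := Finset.univ) (by simp)]
  refine Finset.sum_congr rfl fun k _ => congrArg _ ?_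
  ext t
  simp only [Finset.mem_filter, Finset.mem_inter, Finset.mem_univ, true_and]
  tauto

theorem card_filter_left_eq_sum_termExponent {n : ℕ} [DecidableEq P] [Fintype P] (s : P × P →₀ ℕ)
    (κ : (Σ p : P × P, Fin (s p)) → Fin n) (f : P → Prop) [DecidablePred f] (k : Fin n) :
    (Finset.univ.filter fun t => κ t = k ∧ f t.1.1).card =
      ∑ i ∈ Finset.univ.filter f, termExponent s κ (i, Sum.inl k) := by
  simp only [termExponent, Finsupp.finsetSum_apply, Finsupp.add_apply, Finsupp.single_apply,
    Prod.mk.injEq, Sum.inl.injEq, reduceCtorEq, and_false, if_false, add_zero]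
  rw [Finset.sum_comm, Finset.card_filter]
  refine Finset.sum_congr rfl fun t _ => ?_
  by_cases h1 : κ t = k <;> simp [h1, Finset.sum_ite_eq]

theorem card_filter_right_eq_sum_termExponent {n : ℕ} [DecidableEq P] [Fintype P] (s : P × P →₀ ℕ)
    (κ : (Σ p : P × P, Fin (s p)) → Fin n) (f : P → Prop) [DecidablePred f] (k : Fin n) :
    (Finset.univ.filter fun t => κ t = k ∧ f t.1.2).card =
      ∑ i ∈ Finset.univ.filter f, termExponent s κ (i, Sum.inr k) := by
  simp only [termExponent, Finsupp.finsetSum_apply, Finsupp.add_apply, Finsupp.single_apply,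
    Prod.mk.injEq, Sum.inr.injEq, reduceCtorEq, and_false, if_false, zero_add]
  rw [Finset.sum_comm, Finset.card_filter]
  refine Finset.sum_congr rfl fun t _ => ?_
  by_cases h1 : κ t = k <;> simp [h1, Finset.sum_ite_eq]

/-- Among all monomials with a given term in the vectors and covectors, the corner counts are least
for the one that pairs the rows and columns of each colour in opposite orders: in each of its colour
classes, the factors with row at least `p` and those with column at least `q` are disjoint or cover
the class. -/
theorem cornerCount_le_of_termExponent_eq {m n : ℕ} {s s' : Fin m × Fin m →₀ ℕ}
    {κ : (Σ p : Fin m × Fin m, Fin (s p)) → Fin n} {κ' : (Σ p : Fin m × Fin m, Fin (s' p)) → Fin n}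
    (hκ : ∀ t u, t.1.1 < u.1.1 → t.1.2 < u.1.2 → κ t ≠ κ u)
    (h : termExponent s' κ' = termExponent s κ) : cornerCount s ≤ cornerCount s' := by
  intro p q
  rw [cornerCount_eq_sum_card s κ, cornerCount_eq_sum_card s' κ']
  refine Finset.sum_le_sum fun k _ => ?_
  have hA := card_filter_left_eq_sum_termExponent s κ (fun i => p ≤ i.val) k
  have hB := card_filter_right_eq_sum_termExponent s κ (fun i => q ≤ i.val) k
  have hC := card_filter_left_eq_sum_termExponent s κ (fun _ => True) k
  rw [← h] at hA hB hC
  rw [← card_filter_left_eq_sum_termExponent] at hA hC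
  rw [← card_filter_right_eq_sum_termExponent] at hB
  set A := Finset.univ.filter fun t : (Σ p : Fin m × Fin m, Fin (s p)) => κ t = k ∧ p ≤ t.1.1.val
  set B := Finset.univ.filter fun t : (Σ p : Fin m × Fin m, Fin (s p)) => κ t = k ∧ q ≤ t.1.2.val
  set A' := Finset.univ.filter fun t : (Σ p : Fin m × Fin m, Fin (s' p)) =>
    κ' t = k ∧ p ≤ t.1.1.val
  set B' := Finset.univ.filter fun t : (Σ p : Fin m × Fin m, Fin (s' p)) =>
    κ' t = k ∧ q ≤ t.1.2.val
  simp only [and_true] at hC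
  have h1 := Finset.card_union_add_card_inter A B
  have h2 := Finset.card_union_add_card_inter A' B'
  have h3 : (A' ∪ B').card ≤ (Finset.univ.filter fun t => κ' t = k).card :=
    Finset.card_le_card fun t ht => by
      simp only [A', B', Finset.mem_union, Finset.mem_filter, Finset.mem_univ, true_and] at ht ⊢
      tauto
  by_cases h0 : A ∩ B = ∅
  · rw [h0]
    simp
  · obtain ⟨t, ht⟩ := Finset.nonempty_iff_ne_empty.2 h0
    simp only [A, B, Finset.mem_inter, Finset.mem_filter, Finset.mem_univ, true_and] at ht
    have h4 : A ∪ B = Finset.univ.filter fun t => κ t = k := by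
      ext u
      simp only [A, B, Finset.mem_union, Finset.mem_filter, Finset.mem_univ, true_and]
      refine ⟨by tauto, fun hu => ?_⟩
      by_contra hcon
      refine hκ u t ?_ ?_ (hu.trans ht.1.1.symm)
      · exact (not_le.1 fun h => hcon (Or.inl ⟨hu, h⟩)).trans_le ht.1.2
      · exact (not_le.1 fun h => hcon (Or.inr ⟨hu, h⟩)).trans_le ht.2.2
    rw [h4] at h1
    have h5 : (A ∩ B).card ≤ (A' ∩ B').card := by omega
    exact h5

/-- Standard monomials remain linearly independent after substitution of the pairings. -/
theorem eq_zero_of_standard_of_pairingHom_eq_zero [CharZero K] {m n : ℕ}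
    (f : MvPolynomial (Fin m × Fin m) K) (hf : ∀ s ∈ f.support, IsStandard n s)
    (h0 : pairingHom K (Fin m) n f = 0) : f = 0 := by
  by_contra hne
  obtain ⟨s, hs, hmax⟩ := f.support.exists_maximalFor cornerCount
    (Finset.nonempty_iff_ne_empty.2 fun h => hne (support_eq_empty.1 h))
  let r : Fin m × Fin m → Fin m × Fin m → Prop := fun x y => x.1 < y.1 ∧ x.2 < y.2
  have : IsTrans _ r := ⟨fun x y z h h' => ⟨h.1.trans h'.1, h.2.trans h'.2⟩⟩
  obtain ⟨col, hcol, hcol'⟩ := exists_coloring_of_no_chain r n s.support (hf s hs)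
  have hmem : ∀ t : (Σ p : Fin m × Fin m, Fin (s p)), t.1 ∈ s.support := fun t =>
    Finsupp.mem_support_iff.2 fun h => (Fin.cast h t.2).elim0
  let κ : (Σ p : Fin m × Fin m, Fin (s p)) → Fin n := fun t => ⟨col t.1, hcol _ (hmem t)⟩
  have hκ : ∀ t u, t.1.1 < u.1.1 → t.1.2 < u.1.2 → κ t ≠ κ u := fun t u h h' he =>
    hcol' _ (hmem t) _ (hmem u) ⟨h, h'⟩ (congrArg Fin.val he)
  have hsum : coeff (termExponent s κ) (pairingHom K (Fin m) n f) =
      ∑ s' ∈ f.support, coeff s' f *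
        coeff (termExponent s κ) (pairingHom K (Fin m) n (monomial s' 1)) := by
    conv_lhs => rw [f.as_sum, map_sum, coeff_sum]
    refine Finset.sum_congr rfl fun s' _ => ?_
    rw [← mul_one (coeff s' f), ← smul_eq_mul, ← smul_monomial, map_smul, coeff_smul]
    simp
  rw [h0, coeff_zero, Finset.sum_eq_single s] at hsum
  · rw [coeff_pairingHom_monomial] at hsum
    rcases mul_eq_zero.1 hsum.symm with h | h
    · exact mem_support_iff.1 hs h
    · rw [Nat.cast_eq_zero, Finset.card_eq_zero] at h
      exact Finset.notMem_empty κ (h ▸ by simp)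
  · intro s' hs' hss'
    rw [coeff_pairingHom_monomial, Finset.card_eq_zero.2, Nat.cast_zero, mul_zero]
    refine Finset.filter_eq_empty_iff.2 fun κ' _ hκ' => hss' ?_
    have hle := cornerCount_le_of_termExponent_eq hκ hκ'
    exact cornerCount_injective (le_antisymm (hmax hs' hle) hle)
  · exact fun h => absurd hs h

/-- The second fundamental theorem of invariant theory for the general linear group: the relations
among the pairings of vectors and covectors in dimension `n` are generated by the minors of size
`n + 1`. -/
theorem mem_minorIdeal_of_pairingHom_eq_zero [CharZero K] {m n : ℕ}
    (f : MvPolynomial (Fin m × Fin m) K) (h0 : pairingHom K (Fin m) n f = 0) :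
    f ∈ minorIdeal K (Fin m) n := by
  have hf : f ∈ (minorIdeal K (Fin m) n).restrictScalars K ⊔
      Submodule.span K ((fun s => monomial s 1) '' {s | IsStandard n s}) := by
    rw [f.as_sum]
    refine sum_mem fun s _ => ?_
    rw [← mul_one (coeff s f), ← smul_eq_mul, ← smul_monomial]
    exact Submodule.smul_mem _ _ (monomial_mem_minorIdeal_sup_span_standard m n s)
  obtain ⟨i, hi, g, hg, rfl⟩ := Submodule.mem_sup.1 hf
  have hi0 : pairingHom K (Fin m) n i = 0 := by
    have hle : minorIdeal K (Fin m) n ≤ RingHom.ker (pairingHom K (Fin m) n) := by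
      rw [minorIdeal, Ideal.span_le]
      rintro _ ⟨x, y, rfl⟩
      let U : Matrix (Fin (n + 1)) (Fin n) (MvPolynomial (Fin m × (Fin n ⊕ Fin n)) K) :=
        Matrix.of fun a k => X (x a, Sum.inl k)
      let V : Matrix (Fin n) (Fin (n + 1)) (MvPolynomial (Fin m × (Fin n ⊕ Fin n)) K) :=
        Matrix.of fun k b => X (y b, Sum.inr k)
      have hUV : (Matrix.of fun a b => X (x a, y b)).map (pairingHom K (Fin m) n) = U * V := by
        ext1 a b
        simp [pairingHom, genericPairing, U, V, Matrix.mul_apply]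
      change pairingHom K (Fin m) n _ = 0
      rw [AlgHom.map_det]
      change Matrix.det (Matrix.map _ _) = 0
      rw [hUV]
      exact det_mul_eq_zero U V
    exact hle hi
  have hgs : ∀ s ∈ g.support, IsStandard n s := by
    intro s hs
    by_contra hns
    refine mem_support_iff.1 hs ?_
    clear hf h0 hs
    induction hg using Submodule.span_induction with
    | mem x hx =>
      classical
      obtain ⟨s', hs', rfl⟩ := hx
      exact (coeff_monomial _ _ _).trans (if_neg (by rintro rfl; exact hns hs'))
    | zero => simp
    | add x y _ _ hx hy => rw [coeff_add, hx, hy, add_zero]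
    | smul a x _ hx => rw [coeff_smul, hx, smul_zero]
  rw [map_add, hi0, zero_add] at h0
  rw [eq_zero_of_standard_of_pairingHom_eq_zero g hgs h0, add_zero]
  exact hi

end Minors

/-! ### The Fischer form -/

section Fischer

variable {σ : Type*} [Fintype σ]

/-- The Fischer form on polynomials with rational coefficients: monomials are orthogonal, and the
square of the monomial with exponents `s` is `∏ sᵢ!`. -/
noncomputable def fischer : MvPolynomial σ ℚ →ₗ[ℚ] MvPolynomial σ ℚ →ₗ[ℚ] ℚ :=
  (basisMonomials σ ℚ).constr ℚ fun s => (∏ i, ((s i).factorial : ℚ)) • lcoeff ℚ s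

theorem fischer_monomial (s : σ →₀ ℕ) (a : ℚ) (g : MvPolynomial σ ℚ) :
    fischer (monomial s a) g = a * ((∏ i, ((s i).factorial : ℚ)) * coeff s g) := by
  have h : monomial s a = a • basisMonomials σ ℚ s := by simp [smul_monomial]
  rw [h, map_smul, fischer, Module.Basis.constr_basis]
  simp [lcoeff]

theorem fischer_eq_sum (f g : MvPolynomial σ ℚ) : fischer f g =
    ∑ s ∈ f.support, coeff s f * ((∏ i, ((s i).factorial : ℚ)) * coeff s g) := by
  conv_lhs => rw [f.as_sum, map_sum, LinearMap.sum_apply]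
  simp only [fischer_monomial]

theorem fischer_comm (f g : MvPolynomial σ ℚ) : fischer f g = fischer g f := by
  classical
  induction f using MvPolynomial.induction_on' with
  | add f f' h h' => rw [map_add, LinearMap.add_apply, h, h', map_add]
  | monomial s a =>
    induction g using MvPolynomial.induction_on' with
    | add g g' h h' => rw [map_add, h, h', map_add, LinearMap.add_apply]
    | monomial t b =>
      simp only [fischer_monomial, coeff_monomial]
      by_cases h : t = s
      · subst h
        simp only [if_true]
        ring
      · simp [h, Ne.symm h]

theorem fischer_self_eq_zero {f : MvPolynomial σ ℚ} (h : fischer f f = 0) : f = 0 := by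
  rw [fischer_eq_sum, Finset.sum_eq_zero_iff_of_nonneg] at h
  · ext s
    by_contra hs
    have := h s (mem_support_iff.2 hs)
    have hpos : (∏ i, ((s i).factorial : ℚ)) ≠ 0 :=
      Finset.prod_ne_zero_iff.2 fun i _ => Nat.cast_ne_zero.2 (Nat.factorial_ne_zero _)
    exact mul_ne_zero hs (mul_ne_zero hpos hs) this
  · intro s _
    have hpos : (0 : ℚ) ≤ ∏ i, ((s i).factorial : ℚ) :=
      Finset.prod_nonneg fun i _ => Nat.cast_nonneg _
    rw [mul_left_comm]
    exact mul_nonneg hpos (mul_self_nonneg _)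

/-- Multiplication by a variable is adjoint to the corresponding partial derivative. -/
theorem fischer_X_mul (i : σ) (f g : MvPolynomial σ ℚ) :
    fischer (X i * f) g = fischer f (pderiv i g) := by
  classical
  induction f using MvPolynomial.induction_on' with
  | add f f' h h' => rw [mul_add, map_add, LinearMap.add_apply, h, h', map_add, LinearMap.add_apply]
  | monomial s a =>
    have h : X i * monomial s a = monomial (s + Finsupp.single i 1) a := by
      rw [X, monomial_mul, one_mul, add_comm]
    have h' : (∏ j, (((s + Finsupp.single i 1 : σ →₀ ℕ) j).factorial : ℚ)) =
        (s i + 1) * ∏ j, ((s j).factorial : ℚ) := by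
      rw [← Finset.mul_prod_erase _ _ (Finset.mem_univ i),
        ← Finset.mul_prod_erase _ (fun j => ((s j).factorial : ℚ)) (Finset.mem_univ i), ← mul_assoc]
      congr 1
      · simp [Nat.factorial_succ]
      · refine Finset.prod_congr rfl fun j hj => ?_
        rw [Finsupp.add_apply, Finsupp.single_eq_of_ne (Finset.ne_of_mem_erase hj), add_zero]
    rw [h, fischer_monomial, fischer_monomial, coeff_pderiv, h']
    ring

/-- The span of homogeneous polynomials has an orthogonal complement for the Fischer form: only the
finitely many degrees up to that of `f` matter for the projection of `f`. -/
theorem exists_fischer_projection {ι : Type*} (v : ι → MvPolynomial σ ℚ) (d : ι → ℕ)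
    (hv : ∀ i, (v i).IsHomogeneous (d i)) (f : MvPolynomial σ ℚ) :
    ∃ w ∈ Submodule.span ℚ (Set.range v), ∀ w' ∈ Submodule.span ℚ (Set.range v),
      fischer (f - w) w' = 0 := by
  let N := f.totalDegree
  let W := Submodule.span ℚ (v '' {i | d i ≤ N})
  have hWN : W ≤ restrictTotalDegree σ ℚ N := by
    refine Submodule.span_le.2 ?_
    rintro _ ⟨i, hi, rfl⟩
    exact (mem_restrictTotalDegree _ _ _).2 ((hv i).totalDegree_le.trans hi)
  have : FiniteDimensional ℚ W := Submodule.finiteDimensional_of_le hWN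
  let T : W →ₗ[ℚ] Module.Dual ℚ W := fischer.compl₁₂ W.subtype W.subtype
  have hT : Function.Injective T := by
    rw [← LinearMap.ker_eq_bot, LinearMap.ker_eq_bot']
    intro w hw
    exact Subtype.ext (fischer_self_eq_zero (LinearMap.congr_fun hw w))
  obtain ⟨w, hw⟩ := (LinearMap.injective_iff_surjective_of_finrank_eq_finrank
    Subspace.dual_finrank_eq.symm).1 hT (fischer f ∘ₗ W.subtype)
  refine ⟨w, Submodule.span_mono (Set.image_subset_range _ _) w.2, fun w' hw' => ?_⟩
  suffices hs : Submodule.span ℚ (Set.range v) ≤ LinearMap.ker (fischer (f - w.1)) from hs hw'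
  refine Submodule.span_le.2 ?_
  rintro _ ⟨i, rfl⟩
  change fischer (f - w.1) (v i) = 0
  by_cases hi : d i ≤ N
  · have := LinearMap.congr_fun hw ⟨v i, Submodule.subset_span ⟨i, hi, rfl⟩⟩
    rw [map_sub, LinearMap.sub_apply, sub_eq_zero]
    exact this.symm
  · have hdeg : f - w.1 ∈ restrictTotalDegree σ ℚ N :=
      sub_mem ((mem_restrictTotalDegree _ _ _).2 le_rfl) (hWN w.2)
    rw [fischer_eq_sum]
    refine Finset.sum_eq_zero fun s hs => ?_
    rw [(hv i).coeff_eq_zero, mul_zero, mul_zero]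
    intro hsd
    exact hi (hsd ▸ (le_totalDegree hs).trans ((mem_restrictTotalDegree _ _ _).1 hdeg))

end Fischer

section Contraction

variable {K : Type*} [Field K] {P : Type*} {n : ℕ}

theorem pairingHom_X (p q : P) :
    pairingHom K P n (X (p, q)) = genericPairing K p q := aeval_X _ _

theorem isHomogeneous_pairingHom {f : MvPolynomial (P × P) K} {d : ℕ} (hf : f.IsHomogeneous d) :
    (pairingHom K P n f).IsHomogeneous (2 * d) :=
  hf.aeval _ fun _ => IsHomogeneous.sum _ _ _ fun _ _ => (isHomogeneous_X _ _).mul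
    (isHomogeneous_X _ _)

variable [Fintype P] [DecidableEq P]

theorem pderiv_inr_pairingHom (q : P) (k : Fin n) (f : MvPolynomial (P × P) K) :
    pderiv (q, Sum.inr k) (pairingHom K P n f) =
      ∑ i, X (i, Sum.inl k) * pairingHom K P n (pderiv (i, q) f) := by
  induction f using MvPolynomial.induction_on with
  | C a => simp
  | add f g hf hg => simp only [map_add, hf, hg, mul_add, Finset.sum_add_distrib]
  | mul_X f p hf =>
    obtain ⟨x, y⟩ := p
    have h : pderiv (q, Sum.inr k) (genericPairing K (κ := Fin n) x y) =
        if y = q then X (x, Sum.inl k) else 0 := by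
      simp [genericPairing, Derivation.leibniz, pderiv_X, Pi.single_apply, ite_and]
    have h' : ∀ i, pairingHom K P n (pderiv (i, q) (X (x, y))) =
        if x = i then if y = q then 1 else 0 else 0 := fun i => by
      rw [pderiv_X, Pi.single_apply]
      by_cases h1 : x = i <;> by_cases h2 : y = q <;> simp [h1, h2]
    simp only [map_mul, Derivation.leibniz, smul_eq_mul, hf, pairingHom_X, h, map_add, h',
      Finset.mul_sum, mul_add, Finset.sum_add_distrib, mul_ite, mul_one, mul_zero,
      Finset.sum_ite_eq, Finset.mem_univ, if_true]
    congr 1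
    · split_ifs <;> ring
    · exact Finset.sum_congr rfl fun i _ => by ring

theorem pderiv_inl_pairingHom (q : P) (k : Fin n) (f : MvPolynomial (P × P) K) :
    pderiv (q, Sum.inl k) (pairingHom K P n f) =
      ∑ i, X (i, Sum.inr k) * pairingHom K P n (pderiv (q, i) f) := by
  induction f using MvPolynomial.induction_on with
  | C a => simp
  | add f g hf hg => simp only [map_add, hf, hg, mul_add, Finset.sum_add_distrib]
  | mul_X f p hf =>
    obtain ⟨x, y⟩ := p
    have h : pderiv (q, Sum.inl k) (genericPairing K (κ := Fin n) x y) =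
        if x = q then X (y, Sum.inr k) else 0 := by
      simp [genericPairing, Derivation.leibniz, pderiv_X, Pi.single_apply, ite_and]
    have h' : ∀ i, pairingHom K P n (pderiv (q, i) (X (x, y))) =
        if y = i then if x = q then 1 else 0 else 0 := fun i => by
      rw [pderiv_X, Pi.single_apply]
      by_cases h1 : x = q <;> by_cases h2 : y = i <;> simp [h1, h2]
    simp only [map_mul, Derivation.leibniz, smul_eq_mul, hf, pairingHom_X, h, map_add, h',
      Finset.mul_sum, mul_add, Finset.sum_add_distrib, mul_ite, mul_one, mul_zero,
      Finset.sum_ite_eq, Finset.mem_univ, if_true]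
    congr 1
    · split_ifs <;> ring
    · exact Finset.sum_congr rfl fun i _ => by ring

/-- The operators `∑ₖ ∂²/∂a_{pk}∂b_{qk}`, adjoint to multiplication by the pairings, preserve the
algebra generated by the pairings. -/
theorem sum_pderiv_pairingHom_mem_range (p q : P) (f : MvPolynomial (P × P) K) :
    ∑ k, pderiv (p, Sum.inl k) (pderiv (q, Sum.inr k) (pairingHom K P n f)) ∈
      (pairingHom K P n).range := by
  have h : ∀ k : Fin n, pderiv (p, Sum.inl k) (pderiv (q, Sum.inr k) (pairingHom K P n f)) =
      pairingHom K P n (pderiv (p, q) f) + ∑ i, ∑ j, X (i, Sum.inl k) * X (j, Sum.inr k) *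
        pairingHom K P n (pderiv (p, j) (pderiv (i, q) f)) := by
    intro k
    rw [pderiv_inr_pairingHom, map_sum]
    simp only [Derivation.leibniz, pderiv_inl_pairingHom, pderiv_X, Pi.single_apply, smul_eq_mul,
      Finset.sum_add_distrib, Prod.mk.injEq, and_true, mul_ite, mul_one, mul_zero,
      Finset.sum_ite_eq', Finset.mem_univ, if_true, Finset.mul_sum]
    rw [add_comm]
    simp only [mul_assoc]
  refine ⟨n • pderiv (p, q) f + ∑ i, ∑ j, X (i, j) * pderiv (p, j) (pderiv (i, q) f), ?_⟩
  simp_rw [h]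
  simp only [Finset.sum_add_distrib, Finset.sum_const, Finset.card_univ, Fintype.card_fin]
  change pairingHom K P n _ = _
  simp only [map_add, map_nsmul, map_sum, map_mul, pairingHom_X, genericPairing, Finset.sum_mul]
  congr 1
  conv_rhs => rw [Finset.sum_comm]
  refine Finset.sum_congr rfl fun i _ => ?_
  conv_rhs => rw [Finset.sum_comm]

/-- An element of the algebra generated by the pairings that lies in the ideal generated by the
`⟨a_p, b_p⟩` lies in the ideal that these elements generate in the subalgebra. The component `e`
orthogonal to the latter ideal is annihilated by the operators adjoint to multiplication by the
`⟨a_p, b_p⟩`, hence is orthogonal to itself. -/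
theorem exists_pairingHom_eq_of_mem_span_rat (f : MvPolynomial (P × P) ℚ)
    (hf : pairingHom ℚ P n f ∈
      Ideal.span (Set.range fun p : P => genericPairing ℚ (κ := Fin n) p p)) :
    ∃ y ∈ Ideal.span (Set.range fun p : P => (X (p, p) : MvPolynomial (P × P) ℚ)),
      pairingHom ℚ P n f = pairingHom ℚ P n y := by
  let v : P × (P × P →₀ ℕ) → MvPolynomial (P × (Fin n ⊕ Fin n)) ℚ := fun x =>
    pairingHom ℚ P n (X (x.1, x.1) * monomial x.2 1)
  obtain ⟨w, hw, hort⟩ := exists_fischer_projection v (fun x => 2 * (1 + x.2.degree))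
    (fun x => isHomogeneous_pairingHom ((isHomogeneous_X _ _).mul (isHomogeneous_monomial _ rfl)))
    (pairingHom ℚ P n f)
  let I := Ideal.span (Set.range fun p : P => (X (p, p) : MvPolynomial (P × P) ℚ))
  obtain ⟨y, hy, rfl⟩ : ∃ y ∈ I, pairingHom ℚ P n y = w := by
    suffices hs : Submodule.span ℚ (Set.range v) ≤
        (I.restrictScalars ℚ).map (pairingHom ℚ P n).toLinearMap from hs hw
    refine Submodule.span_le.2 ?_
    rintro _ ⟨x, rfl⟩
    exact ⟨_, Ideal.mul_mem_right _ _ (Ideal.subset_span ⟨x.1, rfl⟩), rfl⟩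
  refine ⟨y, hy, sub_eq_zero.1 ?_⟩
  have hW : ∀ (p : P) g, pairingHom ℚ P n (X (p, p) * g) ∈ Submodule.span ℚ (Set.range v) := by
    intro p g
    induction g using MvPolynomial.induction_on' with
    | add g g' h h' => rw [mul_add, map_add]; exact add_mem h h'
    | monomial s a =>
      have hs : (monomial s a : MvPolynomial (P × P) ℚ) = a • monomial s 1 := by
        rw [smul_monomial, smul_eq_mul, mul_one]
      rw [hs, mul_smul_comm, map_smul]
      exact Submodule.smul_mem _ _ (Submodule.subset_span ⟨(p, s), rfl⟩)
  have hadj : ∀ (p : P) g h, fischer (genericPairing ℚ (κ := Fin n) p p * g) h =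
      fischer g (∑ k, pderiv (p, Sum.inl k) (pderiv (p, Sum.inr k) h)) := by
    intro p g h
    rw [genericPairing, Finset.sum_mul, map_sum, LinearMap.sum_apply, map_sum]
    refine Finset.sum_congr rfl fun k _ => ?_
    rw [mul_assoc, mul_left_comm, fischer_X_mul, fischer_X_mul]
  have hD : ∀ p : P, ∑ k, pderiv (p, Sum.inl k) (pderiv (p, Sum.inr k)
      (pairingHom ℚ P n f - pairingHom ℚ P n y)) = 0 := by
    intro p
    rw [← map_sub]
    obtain ⟨g, hg⟩ := sum_pderiv_pairingHom_mem_range (n := n) p p (f - y)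
    refine fischer_self_eq_zero ?_
    rw [← hadj, ← hg, fischer_comm, map_sub]
    have := hort _ (hW p g)
    rwa [map_mul, pairingHom_X] at this
  refine fischer_self_eq_zero ?_
  have hmem : pairingHom ℚ P n f - pairingHom ℚ P n y ∈
      Ideal.span (Set.range fun p : P => genericPairing ℚ (κ := Fin n) p p) := by
    refine sub_mem hf ?_
    have hle : I ≤ Ideal.comap (pairingHom ℚ P n)
        (Ideal.span (Set.range fun p : P => genericPairing ℚ (κ := Fin n) p p)) := by
      refine Ideal.span_le.2 ?_
      rintro _ ⟨p, rfl⟩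
      exact Ideal.subset_span ⟨p, (pairingHom_X p p).symm⟩
    exact hle hy
  obtain ⟨c, hc⟩ := Ideal.mem_span_range_iff_exists_fun.1 hmem
  nth_rw 1 [← hc]
  rw [map_sum, LinearMap.sum_apply]
  refine Finset.sum_eq_zero fun p _ => ?_
  rw [mul_comm, hadj, hD, map_zero]

end Contraction

/-! ### Descent to rational coefficients -/

section Descent

variable {K : Type*} [Field K] [CharZero K] {σ : Type*}

/-- A `ℚ`-linear form on the field applied to all coefficients of a polynomial. -/
noncomputable def coeffMap (l : K →ₗ[ℚ] ℚ) (f : MvPolynomial σ K) : MvPolynomial σ ℚ :=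
  ∑ s ∈ f.support, monomial s (l (coeff s f))

theorem coeff_coeffMap (l : K →ₗ[ℚ] ℚ) (f : MvPolynomial σ K) (s : σ →₀ ℕ) :
    coeff s (coeffMap l f) = l (coeff s f) := by
  classical
  rw [coeffMap, coeff_sum]
  simp only [coeff_monomial, Finset.sum_ite_eq', mem_support_iff]
  split_ifs with h
  · rfl
  · rw [not_not.1 h, map_zero]

theorem coeffMap_sum (l : K →ₗ[ℚ] ℚ) {ι : Type*} (s : Finset ι) (f : ι → MvPolynomial σ K) :
    coeffMap l (∑ i ∈ s, f i) = ∑ i ∈ s, coeffMap l (f i) := by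
  ext t
  simp only [coeff_coeffMap, coeff_sum, map_sum]

theorem coeffMap_mul_map (l : K →ₗ[ℚ] ℚ) (f : MvPolynomial σ K) (p : MvPolynomial σ ℚ) :
    coeffMap l (f * map (algebraMap ℚ K) p) = coeffMap l f * p := by
  classical
  ext t
  simp only [coeff_coeffMap, coeff_mul, map_sum, coeff_map]
  refine Finset.sum_congr rfl fun x _ => ?_
  rw [mul_comm, ← Algebra.smul_def, map_smul, smul_eq_mul, mul_comm]

theorem coeffMap_C (l : K →ₗ[ℚ] ℚ) (a : K) :
    coeffMap l (C a : MvPolynomial σ K) = C (l a) := by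
  classical
  ext t
  rw [coeff_coeffMap, coeff_C, coeff_C]
  split_ifs <;> simp

theorem eq_sum_coeffMap {ι : Type*} (b : Module.Basis ι ℚ K) (f : MvPolynomial σ K) :
    ∃ T : Finset ι, f = ∑ i ∈ T, C (b i) * map (algebraMap ℚ K) (coeffMap (b.coord i) f) := by
  classical
  refine ⟨f.support.biUnion fun s => (b.repr (coeff s f)).support, ?_⟩
  ext s
  simp only [coeff_sum, coeff_C_mul, coeff_map, coeff_coeffMap, Module.Basis.coord_apply]
  by_cases hs : s ∈ f.support
  · conv_lhs => rw [← b.linearCombination_repr (coeff s f), Finsupp.linearCombination_apply,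
      Finsupp.sum_of_support_subset _ (Finset.subset_biUnion_of_mem
        (fun s => (b.repr (coeff s f)).support) hs) _ (by simp)]
    exact Finset.sum_congr rfl fun i _ => by rw [Algebra.smul_def, mul_comm]
  · rw [notMem_support_iff.1 hs]
    simp

variable {P : Type*} {n : ℕ}

theorem map_genericPairing {R S : Type*} [CommRing R] [CommRing S] (g : R →+* S) {κ : Type*}
    [Fintype κ] (p q : P) : map g (genericPairing R (κ := κ) p q) = genericPairing S p q := by
  simp [genericPairing]

theorem map_pairingHom (f : MvPolynomial (P × P) ℚ) :
    map (algebraMap ℚ K) (pairingHom ℚ P n f) = pairingHom K P n (map (algebraMap ℚ K) f) := by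
  induction f using MvPolynomial.induction_on with
  | C a =>
    rw [map_C, ← algebraMap_eq, ← algebraMap_eq, AlgHom.commutes, AlgHom.commutes, algebraMap_eq,
      map_C, algebraMap_eq]
  | add f g hf hg => simp only [map_add, hf, hg]
  | mul_X f p hf => rw [map_mul, map_mul, hf, map_mul, map_mul, map_X, pairingHom_X, pairingHom_X,
      map_genericPairing]

theorem coeffMap_pairingHom (l : K →ₗ[ℚ] ℚ) (f : MvPolynomial (P × P) K) :
    coeffMap l (pairingHom K P n f) = pairingHom ℚ P n (coeffMap l f) := by
  have h : ∀ s a, coeffMap l (pairingHom K P n (monomial s a)) =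
      pairingHom ℚ P n (coeffMap l (monomial s a)) := by
    intro s a
    have hs : (monomial s a : MvPolynomial (P × P) K) =
        C a * map (algebraMap ℚ K) (monomial s 1) := by
      rw [map_monomial, C_mul_monomial, map_one, mul_one]
    rw [hs, map_mul, ← map_pairingHom, ← algebraMap_eq, AlgHom.commutes, algebraMap_eq,
      algebraMap_eq, coeffMap_mul_map, coeffMap_mul_map, coeffMap_C, coeffMap_C, map_mul,
      ← algebraMap_eq, ← algebraMap_eq, AlgHom.commutes]
  rw [f.as_sum, map_sum, coeffMap_sum, coeffMap_sum, map_sum]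
  exact Finset.sum_congr rfl fun s _ => h _ _

/-- The polynomials in the entries of a matrix that become a combination of the `⟨a_p, b_p⟩` after
substitution of the pairings are generated by the minors and the diagonal entries. -/
theorem mem_of_pairingHom_mem_span {m : ℕ} (f : MvPolynomial (Fin m × Fin m) K)
    (hf : pairingHom K (Fin m) n f ∈
      Ideal.span (Set.range fun p : Fin m => genericPairing K (κ := Fin n) p p)) :
    f ∈ minorIdeal K (Fin m) n ⊔ diagonalIdeal (Fin m) K := by
  obtain ⟨T, hT⟩ := eq_sum_coeffMap (Module.Basis.ofVectorSpace ℚ K) f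
  rw [hT]
  refine sum_mem fun i _ => Ideal.mul_mem_left _ _ ?_
  set l := (Module.Basis.ofVectorSpace ℚ K).coord i
  obtain ⟨c, hc⟩ := Ideal.mem_span_range_iff_exists_fun.1 hf
  obtain ⟨y, hy, hfy⟩ := exists_pairingHom_eq_of_mem_span_rat (n := n) (coeffMap l f) (by
    rw [← coeffMap_pairingHom, ← hc, coeffMap_sum]
    refine sum_mem fun p _ => ?_
    rw [← map_genericPairing (algebraMap ℚ K), coeffMap_mul_map]
    exact Ideal.mul_mem_left _ _ (Ideal.subset_span ⟨p, rfl⟩))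
  have hmin := mem_minorIdeal_of_pairingHom_eq_zero (coeffMap l f - y) (by
    rw [map_sub, hfy, sub_self])
  have h1 : minorIdeal ℚ (Fin m) n ≤
      (minorIdeal K (Fin m) n).comap (map (algebraMap ℚ K)) := by
    refine Ideal.span_le.2 ?_
    rintro _ ⟨x, z, rfl⟩
    refine Ideal.subset_span ⟨x, z, ?_⟩
    rw [RingHom.map_det]
    exact congrArg Matrix.det (Matrix.ext fun a b => map_X _ _)
  have h2 : diagonalIdeal (Fin m) ℚ ≤
      (diagonalIdeal (Fin m) K).comap (map (algebraMap ℚ K)) := by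
    refine Ideal.span_le.2 ?_
    rintro _ ⟨p, rfl⟩
    exact Ideal.subset_span ⟨p, (map_X _ _).symm⟩
  rw [← sub_add_cancel (coeffMap l f) y, map_add]
  exact add_mem (Ideal.mem_sup_left (h1 hmin)) (Ideal.mem_sup_right (h2 hy))

end Descent

/-! ### The rank `n` swapping ring as a ring of pairings -/

section RankRing

variable {K : Type*} [Field K] {P : Type*} {n : ℕ}

/-- The class of the ordered pair `xy` in the rank `n` swapping ring. -/
noncomputable def rankPair (K : Type*) [Field K] {P : Type*} (n : ℕ) (x y : P) : RankRing P K n :=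
  rankMk P K n (pair K x y)

theorem rankMk_surjective (P : Type*) (n : ℕ) : Function.Surjective (rankMk P K n) :=
  Ideal.Quotient.mkₐ_surjective K (rankIdeal P K n)

theorem rankDet_eq_det {k : ℕ} (x y : Fin k → P) :
    rankDet K n x y = (Matrix.of fun i j => rankPair K n (x i) (y j)).det := by
  rw [rankDet, swapDet, AlgHom.map_det]
  rfl

theorem rankPair_self (x : P) : rankPair K n x x = 0 := by
  have h : pair K x x = 0 :=
    Ideal.Quotient.eq_zero_iff_mem.2 (Ideal.subset_span ⟨x, rfl⟩)
  rw [rankPair, h, map_zero]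

theorem rankDet_succ_eq_zero (x y : Fin (n + 1) → P) : rankDet K n x y = 0 :=
  Ideal.Quotient.eq_zero_iff_mem.2 (Ideal.subset_span ⟨x, y, rfl⟩)

/-- The homomorphism from the rank `n` swapping ring that sends `xy` to `⟨a_x, b_y⟩`, for vectors
`a_x` and covectors `b_x` with `⟨a_x, b_x⟩ = 0`. -/
noncomputable def rankLift {S : Type*} [CommRing S] [Algebra K S] (a b : P → Fin n → S)
    (h : ∀ x, a x ⬝ᵥ b x = 0) : RankRing P K n →ₐ[K] S :=
  let f : SwapRing P K →ₐ[K] S := Ideal.Quotient.liftₐ (diagonalIdeal P K)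
    (aeval fun p => a p.1 ⬝ᵥ b p.2) fun g hg => by
      have hle : diagonalIdeal P K ≤
          RingHom.ker (aeval fun p => a p.1 ⬝ᵥ b p.2 : MvPolynomial (P × P) K →ₐ[K] S) := by
        refine Ideal.span_le.2 ?_
        rintro _ ⟨x, rfl⟩
        simpa using h x
      exact hle hg
  Ideal.Quotient.liftₐ (rankIdeal P K n) f fun g hg => by
    have hle : rankIdeal P K n ≤ RingHom.ker f := by
      refine Ideal.span_le.2 ?_
      rintro _ ⟨x, y, rfl⟩
      have hf : (Matrix.of fun i j => pair K (x i) (y j)).map f =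
          (Matrix.of fun i => a (x i)) * (Matrix.of fun j => b (y j)).transpose :=
        Matrix.ext fun i j => aeval_X _ _
      change f (Matrix.det _) = 0
      rw [AlgHom.map_det]
      change Matrix.det (Matrix.map _ _) = 0
      rw [hf]
      exact det_mul_eq_zero _ _
    exact hle hg

theorem rankLift_mk {S : Type*} [CommRing S] [Algebra K S] (a b : P → Fin n → S)
    (h : ∀ x, a x ⬝ᵥ b x = 0) (f : MvPolynomial (P × P) K) :
    rankLift a b h (rankMk P K n (swapMk P K f)) = aeval (fun p => a p.1 ⬝ᵥ b p.2) f := rfl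

theorem rankLift_rankPair {S : Type*} [CommRing S] [Algebra K S] (a b : P → Fin n → S)
    (h : ∀ x, a x ⬝ᵥ b x = 0) (x y : P) :
    rankLift a b h (rankPair K n x y) = a x ⬝ᵥ b y :=
  aeval_X _ _

theorem rankLift_rankDet {S : Type*} [CommRing S] [Algebra K S] (a b : P → Fin n → S)
    (h : ∀ x, a x ⬝ᵥ b x = 0) (x y : Fin n → P) :
    rankLift a b h (rankDet K n x y) =
      (Matrix.of fun i => a (x i)).det * (Matrix.of fun j => b (y j)).det := by
  rw [rankDet_eq_det, AlgHom.map_det, ← Matrix.det_transpose (Matrix.of fun j => b (y j)),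
    ← Matrix.det_mul]
  exact congrArg Matrix.det (Matrix.ext fun i j => rankLift_rankPair a b h _ _)

theorem rankMk_swapMk_eq_zero {f : MvPolynomial (P × P) K}
    (hf : f ∈ minorIdeal K P n ⊔ diagonalIdeal P K) : rankMk P K n (swapMk P K f) = 0 := by
  suffices hle : minorIdeal K P n ⊔ diagonalIdeal P K ≤
      RingHom.ker ((rankMk P K n).comp (swapMk P K)) from hle hf
  refine sup_le (Ideal.span_le.2 ?_) (Ideal.span_le.2 ?_)
  · rintro _ ⟨x, y, rfl⟩
    change rankMk P K n (swapMk P K _) = 0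
    rw [AlgHom.map_det]
    exact rankDet_succ_eq_zero x y
  · rintro _ ⟨x, rfl⟩
    exact rankPair_self x

/-- The maximal nonzero minors are not zero divisors: the rank `n` swapping ring embeds in the
coordinate ring of the variety of vectors and covectors with `⟨a_p, b_p⟩ = 0`, which is integral,
and there the minor is the product of a minor of the vectors and a minor of the covectors. -/
theorem rankDet_mem_nonZeroDivisors [CharZero K] {m : ℕ} (hn : 2 ≤ n) {x v : Fin n → Fin m}
    (hx : Function.Injective x) (hv : Function.Injective v) :
    rankDet K n x v ∈ nonZeroDivisors (RankRing (Fin m) K n) := by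
  have : Nontrivial (Fin n) := Fin.nontrivial_iff_two_le.2 hn
  let J := Ideal.span (Set.range fun p : Fin m => genericPairing K (κ := Fin n) p p)
  have hJ : J.IsPrime := isPrime_span_genericPairing (Fin m)
  let Q := MvPolynomial (Fin m × (Fin n ⊕ Fin n)) K ⧸ J
  let a : Fin m → Fin n → Q := fun p k => Ideal.Quotient.mk J (X (p, Sum.inl k))
  let b : Fin m → Fin n → Q := fun p k => Ideal.Quotient.mk J (X (p, Sum.inr k))
  have hpair : ∀ p q, a p ⬝ᵥ b q = Ideal.Quotient.mk J (genericPairing K p q) := by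
    intro p q
    simp [a, b, genericPairing, dotProduct]
  have hab : ∀ p, a p ⬝ᵥ b p = 0 := fun p => by
    rw [hpair]
    exact Ideal.Quotient.eq_zero_iff_mem.2 (Ideal.subset_span ⟨p, rfl⟩)
  have hlift : ∀ f, rankLift a b hab (rankMk _ K n (swapMk _ K f)) =
      Ideal.Quotient.mk J (pairingHom K (Fin m) n f) := by
    intro f
    rw [rankLift_mk]
    simp_rw [hpair]
    rw [pairingHom, ← Ideal.Quotient.mkₐ_eq_mk K, ← AlgHom.comp_apply, comp_aeval]
  have hA : (Matrix.of fun i => a (x i)).det ≠ 0 := by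
    intro h0
    let g : MvPolynomial (Fin m × (Fin n ⊕ Fin n)) K →ₐ[K] K :=
      aeval fun t => Sum.elim (fun k => if t.1 = x k then 1 else 0) (fun _ => 0) t.2
    have hg : J ≤ RingHom.ker g := by
      refine Ideal.span_le.2 ?_
      rintro _ ⟨p, rfl⟩
      change g _ = 0
      simp [g, genericPairing]
    have h1 := hg (Ideal.Quotient.eq_zero_iff_mem.1 ((RingHom.map_det (Ideal.Quotient.mk J)
      (Matrix.of fun i k => X (x i, Sum.inl k))).trans h0))
    have h2 : g (Matrix.of fun i k => X (x i, Sum.inl k)).det = 1 := by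
      rw [AlgHom.map_det, ← Matrix.det_one (n := Fin n)]
      refine congrArg Matrix.det (Matrix.ext fun i k => ?_)
      simp [g, Matrix.one_apply, hx.eq_iff]
    exact one_ne_zero (h2.symm.trans h1)
  have hB : (Matrix.of fun i => b (v i)).det ≠ 0 := by
    intro h0
    let g : MvPolynomial (Fin m × (Fin n ⊕ Fin n)) K →ₐ[K] K :=
      aeval fun t => Sum.elim (fun _ => 0) (fun k => if t.1 = v k then 1 else 0) t.2
    have hg : J ≤ RingHom.ker g := by
      refine Ideal.span_le.2 ?_
      rintro _ ⟨p, rfl⟩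
      change g _ = 0
      simp [g, genericPairing]
    have h1 := hg (Ideal.Quotient.eq_zero_iff_mem.1 ((RingHom.map_det (Ideal.Quotient.mk J)
      (Matrix.of fun i k => X (v i, Sum.inr k))).trans h0))
    have h2 : g (Matrix.of fun i k => X (v i, Sum.inr k)).det = 1 := by
      rw [AlgHom.map_det, ← Matrix.det_one (n := Fin n)]
      refine congrArg Matrix.det (Matrix.ext fun i k => ?_)
      simp [g, Matrix.one_apply, hv.eq_iff]
    exact one_ne_zero (h2.symm.trans h1)
  rw [mem_nonZeroDivisors_iff_right]
  intro z hz
  obtain ⟨z, rfl⟩ := rankMk_surjective _ n z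
  obtain ⟨f, rfl⟩ := swapMk_surjective _ K z
  have h := congrArg (rankLift a b hab) hz
  rw [map_mul, map_zero, rankLift_rankDet, hlift] at h
  have h0 := (mul_eq_zero.1 h).resolve_right (mul_ne_zero hA hB)
  exact rankMk_swapMk_eq_zero (mem_of_pairingHom_mem_span f (Ideal.Quotient.eq_zero_iff_mem.1 h0))

end RankRing

/-! ### Coordinates of the points in a basis of points -/

section Coordinates

variable {K : Type*} [Field K] {P : Type*} {n : ℕ}

/-- The class of the ordered pair `xy` in the rank `n` swapping fraction ring. -/
noncomputable def fracPair (K : Type*) [Field K] {P : Type*} (n : ℕ) (x y : P) :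
    RankFraction P K n :=
  algebraMap (RankRing P K n) _ (rankPair K n x y)

theorem algebraMap_rankDet {k : ℕ} (x y : Fin k → P) :
    algebraMap (RankRing P K n) (RankFraction P K n) (rankDet K n x y) =
      (Matrix.of fun i j => fracPair K n (x i) (y j)).det := by
  rw [rankDet_eq_det, RingHom.map_det]
  rfl

/-- The matrix of the pairs with left entries `e` and right entries `v`. -/
noncomputable def fracMatrix (K : Type*) [Field K] {P : Type*} {n : ℕ} (e v : Fin n → P) :
    Matrix (Fin n) (Fin n) (RankFraction P K n) :=
  Matrix.of fun i j => fracPair K n (e i) (v j)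

theorem isUnit_det_fracMatrix {e v : Fin n → P}
    (h : rankDet K n e v ∈ nonZeroDivisors (RankRing P K n)) :
    IsUnit (fracMatrix K e v).det := by
  rw [fracMatrix, ← algebraMap_rankDet]
  exact IsLocalization.map_units (RankFraction P K n) ⟨_, h⟩

/-- The coordinates of the row of `x` in the basis of the rows of the points `e`, computed from the
columns `v`. -/
noncomputable def fracCoord (K : Type*) [Field K] {P : Type*} {n : ℕ} (e v : Fin n → P) (x : P) :
    Fin n → RankFraction P K n :=
  Matrix.vecMul (fun b => fracPair K n x (v b)) (fracMatrix K e v)⁻¹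

variable {e v : Fin n → P}

/-- All `(n + 1) × (n + 1)` minors vanish, so the coordinates do not depend on the columns. -/
theorem fracPair_eq_sum (h : rankDet K n e v ∈ nonZeroDivisors (RankRing P K n)) (x y : P) :
    fracPair K n x y = ∑ k, fracCoord K e v x k * fracPair K n (e k) y := by
  let r : Fin n ⊕ Fin 1 → P := Sum.elim e fun _ => x
  let c : Fin n ⊕ Fin 1 → P := Sum.elim v fun _ => y
  have := (fracMatrix K e v).invertibleOfIsUnitDet (isUnit_det_fracMatrix h)
  let B : Matrix (Fin n) (Fin 1) (RankFraction P K n) := Matrix.of fun k _ => fracPair K n (e k) y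
  let C : Matrix (Fin 1) (Fin n) (RankFraction P K n) := Matrix.of fun _ l => fracPair K n x (v l)
  let D : Matrix (Fin 1) (Fin 1) (RankFraction P K n) := Matrix.of fun _ _ => fracPair K n x y
  have h1 : (Matrix.fromBlocks (fracMatrix K e v) B C D).det = 0 := by
    have h2 := rankDet_succ_eq_zero (K := K) (fun i => r (finSumFinEquiv.symm i))
      (fun i => c (finSumFinEquiv.symm i))
    have h3 := algebraMap_rankDet (K := K) (n := n) (fun i => r (finSumFinEquiv.symm i))
      (fun i => c (finSumFinEquiv.symm i))
    rw [h2, map_zero] at h3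
    rw [h3, ← Matrix.det_submatrix_equiv_self finSumFinEquiv.symm]
    refine congrArg Matrix.det (Matrix.ext fun i j => ?_)
    simp only [Matrix.submatrix_apply, Matrix.of_apply]
    rcases finSumFinEquiv.symm i with i | i <;> rcases finSumFinEquiv.symm j with j | j <;> rfl
  rw [Matrix.det_fromBlocks₁₁, (isUnit_det_fracMatrix h).mul_right_eq_zero, Matrix.det_fin_one,
    Matrix.sub_apply, sub_eq_zero, Matrix.invOf_eq_nonsing_inv] at h1
  exact h1

theorem coord_ext (h : rankDet K n e v ∈ nonZeroDivisors (RankRing P K n))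
    {c d : Fin n → RankFraction P K n}
    (hcd : ∀ y, ∑ k, c k * fracPair K n (e k) y = ∑ k, d k * fracPair K n (e k) y) : c = d := by
  have h1 : Matrix.vecMul c (fracMatrix K e v) = Matrix.vecMul d (fracMatrix K e v) :=
    funext fun b => hcd (v b)
  have h2 := congrArg (fun w => Matrix.vecMul w (fracMatrix K e v)⁻¹) h1
  simpa only [Matrix.vecMul_vecMul, Matrix.mul_nonsing_inv _ (isUnit_det_fracMatrix h),
    Matrix.vecMul_one] using h2

theorem fracCoord_self (h : rankDet K n e v ∈ nonZeroDivisors (RankRing P K n)) (l k : Fin n) :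
    fracCoord K e v (e l) k = if k = l then 1 else 0 := by
  refine congrFun (coord_ext h (d := fun k => if k = l then 1 else 0) fun y => ?_) k
  rw [← fracPair_eq_sum h]
  simp

/-- A coordinate is the quotient of determinants in which one basis point is replaced. -/
theorem fracCoord_eq_detQuotient (h : rankDet K n e v ∈ nonZeroDivisors (RankRing P K n))
    {r : ℕ} (x : Fin r → P) (w : Fin (r + 1) → P) (k : Fin n)
    (hx : ∀ l, l ≠ k → ∃ t, x t = e l) (z : P)
    (hw : rankDet K n (Fin.snoc x (e k) : Fin (r + 1) → P) w ∈
      nonZeroDivisors (RankRing P K n)) :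
    fracCoord K e v z k = detQuotient K n x z (e k) w := by
  let M : P → Matrix (Fin (r + 1)) (Fin (r + 1)) (RankFraction P K n) := fun z =>
    Matrix.of fun i j => fracPair K n ((Fin.snoc x z : Fin (r + 1) → P) i) (w j)
  have hM : ∀ z', (M z').det =
      Matrix.cramer (M z).transpose (fun j => fracPair K n z' (w j)) (Fin.last r) := by
    intro z'
    rw [Matrix.cramer_transpose_apply]
    refine congrArg Matrix.det (Matrix.ext fun i j => ?_)
    refine Fin.lastCases ?_ (fun i => ?_) i
    · simp [M]
    · rw [Matrix.updateRow_ne (Fin.castSucc_lt_last i).ne]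
      simp [M]
  have h1 : (M z).det = fracCoord K e v z k * (M (e k)).det := by
    have hz : (fun j => fracPair K n z (w j)) =
        ∑ l, fracCoord K e v z l • fun j => fracPair K n (e l) (w j) := by
      ext j
      rw [fracPair_eq_sum h]
      simp
    rw [hM z, hz, map_sum, Finset.sum_apply, Finset.sum_eq_single k]
    · rw [map_smul, Pi.smul_apply, ← hM, smul_eq_mul]
    · intro l _ hl
      obtain ⟨t, ht⟩ := hx l hl
      rw [map_smul, Pi.smul_apply, ← hM,
        Matrix.det_zero_of_row_eq (Fin.castSucc_lt_last t).ne, smul_zero]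
      ext j
      simp [M, ht]
    · exact fun h => absurd (Finset.mem_univ k) h
  have hu : IsUnit (M (e k)).det := by
    rw [← algebraMap_rankDet]
    exact IsLocalization.map_units (RankFraction P K n) ⟨_, hw⟩
  rw [detQuotient]
  simp only [algebraMap_rankDet]
  change _ = (M z).det * Ring.inverse (M (e k)).det
  rw [h1, mul_assoc, Ring.mul_inverse_cancel _ hu, mul_one]

end Coordinates

/-! ### Brackets of coordinates -/

section Linking

variable {P : Type*} [LinearOrder P]

theorem linking_eq_half_sum (r x s y : P) : linking r x s y =
    1 / 2 * (signature r y + signature y x + signature x s + signature s r) := by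
  rw [linking, signature_triple, signature_triple, signature_antisymm x s, signature_antisymm s r]
  ring

set_option maxHeartbeats 4000000 in
/-- The parallel number is half the sum of the signatures around a quadrilateral. -/
theorem parallelNumber_eq_half_sum {i j i' j' : P} (h₁ : i ≠ j) (h₂ : i' ≠ j') (h₃ : i ≠ j')
    (h₄ : i' ≠ j) : parallelNumber i j i' j' =
      1 / 2 * (signature i j + signature i' i + signature j' i' + signature j j') := by
  rcases lt_trichotomy i i' with h | h | h <;> rcases lt_trichotomy j j' with h' | h' | h' <;>
  rcases h₁.lt_or_gt with h₁ | h₁ <;> try subst h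
  all_goals try subst h'
  all_goals rcases h₂.lt_or_gt with h₂ | h₂
  all_goals try (exfalso; order)
  all_goals rcases h₃.lt_or_gt with h₃ | h₃
  all_goals try (exfalso; order)
  all_goals rcases h₄.lt_or_gt with h₄ | h₄
  all_goals try (exfalso; order)
  all_goals
    simp only [parallelNumber, Cyclic₄, Cyclic₃, signature, *, not_lt_of_gt, lt_irrefl, ne_of_lt,
      ne_of_gt, if_true, if_false, and_true, and_false, or_false, false_or, or_self, and_self]
    norm_num

end Linking

/-- Two brackets that agree on the variables of a polynomial ring agree. -/
theorem biderivation_hom_ext {K Q σ : Type*} [CommRing K] [CommRing Q] [Algebra K Q]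
    (D : Biderivation K (MvPolynomial σ K)) (E : Biderivation K Q)
    (θ : MvPolynomial σ K →ₐ[K] Q) (h : ∀ p q, θ (D (X p) (X q)) = E (θ (X p)) (θ (X q)))
    (f g : MvPolynomial σ K) : θ (D f g) = E (θ f) (θ g) := by
  have hc : ∀ a : K, θ (C a) = algebraMap K Q a := fun a => by
    rw [← algebraMap_eq, AlgHom.commutes]
  induction f using MvPolynomial.induction_on with
  | C a => rw [hc, Derivation.map_algebraMap, ← algebraMap_eq, Derivation.map_algebraMap]; simp
  | add f f' h h' => simp only [map_add, Derivation.add_apply, h, h']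
  | mul_X f p hf =>
    have hp : θ (D (X p) g) = E (θ (X p)) (θ g) := by
      clear hf
      induction g using MvPolynomial.induction_on with
      | C a =>
        rw [hc, Derivation.map_algebraMap, ← algebraMap_eq, Derivation.map_algebraMap, map_zero]
      | add g g' h h' => simp only [map_add, h, h']
      | mul_X g q hg =>
        simp only [map_mul, Derivation.leibniz, map_add, smul_eq_mul, h, hg]
    simp only [map_mul, Derivation.leibniz, Derivation.add_apply, Derivation.smul_apply, map_add,
      smul_eq_mul, hp, hf]

section Bracket

variable {K : Type*} [Field K] [CharZero K] {P : Type*} [LinearOrder P] {n : ℕ}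

/-- The signature as an element of the rank `n` swapping fraction ring. -/
noncomputable def fracSignature (K : Type*) [Field K] [CharZero K] {P : Type*} [LinearOrder P]
    (n : ℕ) (x y : P) : RankFraction P K n :=
  algebraMap K _ ((signature x y : ℚ) : K)

theorem rankFractionBracket_fracPair (c₁ c₂ : K) (r x s y : P) :
    rankFractionBracket P n c₁ c₂ (fracPair K n r x) (fracPair K n s y) =
      algebraMap K _ (1 / 2) * (fracSignature K n r y + fracSignature K n y x +
        fracSignature K n x s + fracSignature K n s r) *
        (algebraMap K _ c₁ * (fracPair K n r y * fracPair K n s x) +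
          algebraMap K _ c₂ * (fracPair K n r x * fracPair K n s y)) := by
  rw [rankFractionBracket, fracPair, fracPair, fractionBracket_algebraMap, rankPair, rankPair,
    rankBracket_mk, swapBracket_pair, linking_eq_half_sum]
  simp only [map_mul, map_add, AlgHom.commutes, ← IsScalarTower.algebraMap_apply, fracPair,
    rankPair, fracSignature, Rat.cast_mul, Rat.cast_add, Rat.cast_div, Rat.cast_one,
    Rat.cast_ofNat]

variable {e v : Fin n → P}

/-- The bracket of a pair with a coordinate, obtained by applying the derivation `{cd, ·}` to the
expansion of a row in the basis `e`. -/
theorem rankFractionBracket_fracPair_fracCoord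
    (h : rankDet K n e v ∈ nonZeroDivisors (RankRing P K n)) (c₁ c₂ : K) (c d j : P) (k : Fin n) :
    rankFractionBracket P n c₁ c₂ (fracPair K n c d) (fracCoord K e v j k) =
      algebraMap K _ (1 / 2) * (algebraMap K _ c₁ * (fracCoord K e v c k *
        ∑ l, fracCoord K e v j l * fracPair K n (e l) d * (fracSignature K n d j -
          fracSignature K n d (e l) + fracSignature K n j c - fracSignature K n (e l) c)) +
        algebraMap K _ c₂ * (fracPair K n c d * fracCoord K e v j k * (fracSignature K n d j +
          fracSignature K n j c - fracSignature K n d (e k) - fracSignature K n (e k) c))) := by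
  revert k
  refine congrFun (coord_ext h fun y => ?_)
  have h1 := congrArg (rankFractionBracket P n c₁ c₂ (fracPair K n c d)) (fracPair_eq_sum h j y)
  simp only [map_sum, Derivation.leibniz, smul_eq_mul, Finset.sum_add_distrib,
    rankFractionBracket_fracPair] at h1
  have h2 : ∑ k, rankFractionBracket P n c₁ c₂ (fracPair K n c d) (fracCoord K e v j k) *
      fracPair K n (e k) y = ∑ k, fracPair K n (e k) y *
        rankFractionBracket P n c₁ c₂ (fracPair K n c d) (fracCoord K e v j k) :=
    Finset.sum_congr rfl fun k _ => mul_comm _ _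
  rw [h2, ← sub_eq_iff_eq_add'.2 h1]
  have hj : ∀ z, algebraMap K _ (1 / 2) * (fracSignature K n c y + fracSignature K n y d +
      fracSignature K n d j + fracSignature K n j c) * fracPair K n j z =
      ∑ k, algebraMap K _ (1 / 2) * (fracSignature K n c y + fracSignature K n y d +
      fracSignature K n d j + fracSignature K n j c) *
        (fracCoord K e v j k * fracPair K n (e k) z) := fun z => by
    rw [fracPair_eq_sum h j z, Finset.mul_sum]
  have hc : ∀ t, ∑ k, fracCoord K e v c k * t * fracPair K n (e k) y =
      t * fracPair K n c y := fun t => by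
    rw [fracPair_eq_sum h c y, Finset.mul_sum]
    exact Finset.sum_congr rfl fun k _ => by ring
  have hL : ∑ k, algebraMap K _ (1 / 2) * (algebraMap K _ c₁ * (fracCoord K e v c k *
        ∑ l, fracCoord K e v j l * fracPair K n (e l) d * (fracSignature K n d j -
          fracSignature K n d (e l) + fracSignature K n j c - fracSignature K n (e l) c)) +
        algebraMap K _ c₂ * (fracPair K n c d * fracCoord K e v j k * (fracSignature K n d j +
          fracSignature K n j c - fracSignature K n d (e k) - fracSignature K n (e k) c))) *
          fracPair K n (e k) y =
      algebraMap K _ (1 / 2) * (algebraMap K _ c₁ * ∑ k, fracCoord K e v c k *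
        (∑ l, fracCoord K e v j l * fracPair K n (e l) d * (fracSignature K n d j -
          fracSignature K n d (e l) + fracSignature K n j c - fracSignature K n (e l) c)) *
          fracPair K n (e k) y +
        algebraMap K _ c₂ * ∑ k, fracPair K n c d * fracCoord K e v j k * (fracSignature K n d j +
          fracSignature K n j c - fracSignature K n d (e k) - fracSignature K n (e k) c) *
          fracPair K n (e k) y) := by
    rw [mul_add, Finset.mul_sum, Finset.mul_sum, Finset.mul_sum, Finset.mul_sum,
      ← Finset.sum_add_distrib]
    exact Finset.sum_congr rfl fun k _ => by ring
  rw [hL, hc, mul_add, mul_left_comm _ (algebraMap K _ c₁), mul_left_comm _ (algebraMap K _ c₂),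
    mul_left_comm _ (fracPair K n c y), mul_left_comm _ (fracPair K n c d), hj, hj]
  simp only [Finset.mul_sum, Finset.sum_mul, ← Finset.sum_add_distrib, ← Finset.sum_sub_distrib]
  exact Finset.sum_congr rfl fun k _ => by ring

/-- The bracket of two coordinates. -/
theorem rankFractionBracket_fracCoord
    (h : rankDet K n e v ∈ nonZeroDivisors (RankRing P K n)) (c₁ c₂ : K) (j j' : P) (k k' : Fin n) :
    rankFractionBracket P n c₁ c₂ (fracCoord K e v j k) (fracCoord K e v j' k') =
      algebraMap K _ (1 / 2) * (algebraMap K _ c₁ * (fracCoord K e v j k' * fracCoord K e v j' k *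
        (fracSignature K n j' j - fracSignature K n (e k) j - fracSignature K n j' (e k') +
          fracSignature K n (e k) (e k'))) +
        algebraMap K _ c₂ * (fracCoord K e v j' k' * fracCoord K e v j k *
          (fracSignature K n j' j - fracSignature K n (e k') j - fracSignature K n j' (e k) +
          fracSignature K n (e k') (e k)))) := by
  revert k
  refine congrFun (coord_ext h fun d => ?_)
  have hsum : ∀ f : Fin n → RankFraction P K n,
      rankFractionBracket P n c₁ c₂ (∑ l, f l) (fracCoord K e v j' k') =
        ∑ l, rankFractionBracket P n c₁ c₂ (f l) (fracCoord K e v j' k') := fun f => by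
    rw [map_sum]
    exact (congrFun (map_sum (Derivation.coeFnAddMonoidHom (R := K) (A := RankFraction P K n)
      (M := RankFraction P K n)) _ _) _).trans (Finset.sum_apply _ _ _)
  have h1 := congrArg (fun z => rankFractionBracket P n c₁ c₂ z (fracCoord K e v j' k'))
    (fracPair_eq_sum h j d)
  simp only [hsum, Derivation.leibniz, Derivation.add_apply, Derivation.smul_apply, smul_eq_mul,
    Finset.sum_add_distrib, rankFractionBracket_fracPair_fracCoord h, fracCoord_self h] at h1
  have h2 : ∑ k, rankFractionBracket P n c₁ c₂ (fracCoord K e v j k) (fracCoord K e v j' k') *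
      fracPair K n (e k) d = ∑ k, fracPair K n (e k) d *
        rankFractionBracket P n c₁ c₂ (fracCoord K e v j k) (fracCoord K e v j' k') :=
    Finset.sum_congr rfl fun k _ => mul_comm _ _
  rw [h2, ← sub_eq_iff_eq_add'.2 h1]
  -- The row of `e l` has coordinates `δ`, so the `c₁` terms of its brackets vanish unless `l = k'`.
  have h3 : ∀ (S T : Fin n → RankFraction P K n), ∑ l, fracCoord K e v j l *
      (algebraMap K _ (1 / 2) * (algebraMap K _ c₁ * ((if k' = l then 1 else 0) * S l) +
        algebraMap K _ c₂ * T l)) = algebraMap K _ (1 / 2) * (algebraMap K _ c₁ *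
          (fracCoord K e v j k' * S k')) +
        ∑ l, algebraMap K _ (1 / 2) * (algebraMap K _ c₂ * (fracCoord K e v j l * T l)) := by
    intro S T
    have : ∀ l, fracCoord K e v j l *
      (algebraMap K _ (1 / 2) * (algebraMap K _ c₁ * ((if k' = l then 1 else 0) * S l) +
        algebraMap K _ c₂ * T l)) = (if k' = l then algebraMap K _ (1 / 2) * (algebraMap K _ c₁ *
          (fracCoord K e v j l * S l)) else 0) +
          algebraMap K _ (1 / 2) * (algebraMap K _ c₂ * (fracCoord K e v j l * T l)) := by
      intro l
      split_ifs <;> ring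
    simp only [this, Finset.sum_add_distrib, Finset.sum_ite_eq, Finset.mem_univ, if_true]
  have h4 : ∀ t : RankFraction P K n, fracPair K n j d * t =
      ∑ l, fracCoord K e v j l * fracPair K n (e l) d * t := fun t => by
    rw [fracPair_eq_sum h j d, Finset.sum_mul]
  rw [h3 (fun l => ∑ p, fracCoord K e v j' p * fracPair K n (e p) d *
    (fracSignature K n d j' - fracSignature K n d (e p) + fracSignature K n j' (e l) -
      fracSignature K n (e p) (e l)))
    (fun l => fracPair K n (e l) d * fracCoord K e v j' k' * (fracSignature K n d j' +
      fracSignature K n j' (e l) - fracSignature K n d (e k') - fracSignature K n (e k') (e l))),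
    mul_assoc (fracPair K n j d), h4]
  rw [mul_add (algebraMap K (RankFraction P K n) (1 / 2))]
  simp only [Finset.mul_sum]
  simp only [← Finset.sum_add_distrib, ← Finset.sum_sub_distrib]
  exact Finset.sum_congr rfl fun l _ => by ring

end Bracket

/-! ### Injectivity -/

/-- A specialization of elements of a ring with a common denominator `d` that sends `d` to one
respects their algebraic relations. -/
theorem aeval_eq_zero_of_common_denominator {K Z Q S σ : Type*} [CommRing K] [CommRing Z]
    [CommRing Q] [CommRing S] [Algebra K Z] [Algebra K Q] [Algebra K S] (ι : Z →ₐ[K] Q)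
    (hι : Function.Injective ι) (ρ : Z →ₐ[K] S) {d : Z} (hd : ρ d = 1) (N : σ → Z) (x : σ → Q)
    (hx : ∀ s, ι d * x s = ι (N s)) {f : MvPolynomial σ K} (hf : aeval x f = 0) :
    aeval (fun s => ρ (N s)) f = 0 := by
  have key : ∀ f : MvPolynomial σ K, ∃ (r : ℕ) (H : Z), ι d ^ r * aeval x f = ι H ∧
      ρ H = aeval (fun s => ρ (N s)) f := by
    intro f
    induction f using MvPolynomial.induction_on with
    | C a => exact ⟨0, algebraMap K Z a, by simp [← algebraMap_eq], by simp [← algebraMap_eq]⟩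
    | add f g hf hg =>
      obtain ⟨r, H, h1, h2⟩ := hf
      obtain ⟨r', H', h1', h2'⟩ := hg
      refine ⟨r + r', d ^ r' * H + d ^ r * H', ?_, ?_⟩
      · simp only [map_add, map_mul, map_pow]
        linear_combination ι d ^ r' * h1 + ι d ^ r * h1'
      · simp only [map_add, map_mul, map_pow, hd, h2, h2', one_pow, one_mul]
    | mul_X f s hf =>
      obtain ⟨r, H, h1, h2⟩ := hf
      refine ⟨r + 1, H * N s, ?_, ?_⟩
      · rw [map_mul, map_mul, aeval_X, ← hx]
        linear_combination ι d * x s * h1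
      · rw [map_mul, map_mul, aeval_X, h2]
  obtain ⟨r, H, h1, h2⟩ := key f
  rw [hf, mul_zero] at h1
  have hH : H = 0 := hι (by rw [← h1, map_zero])
  rw [← h2, hH, map_zero]

section Coordinates

variable {K : Type*} [Field K] {P : Type*} {n : ℕ} {e v : Fin n → P}

/-- Cramer's rule for the coordinates of a row. -/
theorem det_mul_fracCoord (h : rankDet K n e v ∈ nonZeroDivisors (RankRing P K n)) (x : P)
    (k : Fin n) :
    algebraMap (RankRing P K n) (RankFraction P K n) (rankDet K n e v) * fracCoord K e v x k =
      algebraMap (RankRing P K n) (RankFraction P K n) (Matrix.vecMul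
        (fun l => rankPair K n x (v l))
        (Matrix.of fun i j => rankPair K n (e i) (v j)).adjugate k) := by
  have h1 : (fracMatrix K e v).adjugate = (Matrix.of fun i j => rankPair K n (e i)
      (v j)).adjugate.map (algebraMap (RankRing P K n) (RankFraction P K n)) :=
    (RingHom.map_adjugate (algebraMap (RankRing P K n) (RankFraction P K n)) _).symm
  rw [algebraMap_rankDet, fracCoord, Matrix.inv_def, Matrix.vecMul_smul, Pi.smul_apply,
    smul_eq_mul, h1]
  change (fracMatrix K e v).det * _ = _
  rw [Ring.mul_inverse_cancel_left _ _ (isUnit_det_fracMatrix h)]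
  simp only [Matrix.vecMul, dotProduct, map_sum, map_mul, Matrix.map_apply]
  rfl

end Coordinates

section Cell

variable {K : Type*} [Field K] {m n : ℕ} {I : Finset (Fin m)}

/-- The rows of a matrix in the cell of the Grassmannian: unit vectors for the points of `I`, and
the coordinate functions of the cell for the other points. -/
noncomputable def cellVector (K : Type*) [Field K] (hI : I.card = n) (x : Fin m) (k : Fin n) :
    CellRing K I :=
  if h : x ∈ I then if x = I.orderEmbOfFin hI k then 1 else 0
  else X (⟨I.orderEmbOfFin hI k, I.orderEmbOfFin_mem hI k⟩, ⟨x, h⟩)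

/-- Covectors that vanish off `I` and form on `I` a cyclic permutation of the dual basis, so that
they are incident with the vectors `cellVector`. -/
noncomputable def cellCovector (K : Type*) [Field K] (hI : I.card = n) (y : Fin m) (k : Fin n) :
    CellRing K I :=
  if y = I.orderEmbOfFin hI (finRotate n k) then 1 else 0

theorem cellVector_dotProduct_cellCovector (hn : 2 ≤ n) (hI : I.card = n) (x : Fin m) :
    cellVector K hI x ⬝ᵥ cellCovector K hI x = 0 := by
  refine Finset.sum_eq_zero fun k _ => ?_
  rw [cellCovector]
  split_ifs with h
  · have hk : finRotate n k ≠ k := by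
      obtain ⟨n, rfl⟩ := Nat.exists_eq_add_of_le' hn
      rw [finRotate_apply]
      simp
    rw [cellVector, dif_pos (h ▸ I.orderEmbOfFin_mem hI _), if_neg, zero_mul]
    rw [h]
    exact fun h' => hk ((I.orderEmbOfFin hI).injective h')
  · exact mul_zero _

theorem cellVector_dotProduct_cellCovector_finRotate (hI : I.card = n) (x : Fin m) (l : Fin n) :
    cellVector K hI x ⬝ᵥ cellCovector K hI (I.orderEmbOfFin hI (finRotate n l)) =
      cellVector K hI x l := by
  simp [dotProduct, cellCovector]

/-- The coordinates of the points off `I` in the basis `I` are algebraically independent: the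
swapping ring specializes to the matrices in the cell. -/
theorem aeval_fracCoord_injective (hn : 2 ≤ n) (hI : I.card = n)
    (h : rankDet K n (I.orderEmbOfFin hI) (I.orderEmbOfFin hI ∘ finRotate n) ∈
      nonZeroDivisors (RankRing (Fin m) K n)) :
    Function.Injective (aeval fun p => fracCoord K (I.orderEmbOfFin hI)
      (I.orderEmbOfFin hI ∘ finRotate n) p.2.1 ((I.orderIsoOfFin hI).symm p.1) :
        CellRing K I →ₐ[K] RankFraction (Fin m) K n) := by
  rw [injective_iff_map_eq_zero]
  intro f hf
  let e := I.orderEmbOfFin hI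
  let v := I.orderEmbOfFin hI ∘ finRotate n
  let ρ : RankRing (Fin m) K n →ₐ[K] CellRing K I := rankLift (cellVector K hI)
    (cellCovector K hI) (cellVector_dotProduct_cellCovector hn hI)
  have hρ : ∀ x l, ρ (rankPair K n x (v l)) = cellVector K hI x l := fun x l =>
    (rankLift_rankPair _ _ _ _ _).trans (cellVector_dotProduct_cellCovector_finRotate hI x l)
  have hM : (Matrix.of fun i j => rankPair K n (e i) (v j)).map ρ = 1 := by
    ext1 i j
    rw [Matrix.map_apply, Matrix.of_apply, hρ, cellVector, dif_pos (I.orderEmbOfFin_mem hI i),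
      Matrix.one_apply]
    exact if_congr (I.orderEmbOfFin hI).injective.eq_iff rfl rfl
  have hd : ρ (rankDet K n e v) = 1 := by
    rw [rankDet_eq_det, AlgHom.map_det]
    exact (congrArg Matrix.det hM).trans Matrix.det_one
  have hN : ∀ x k, ρ (Matrix.vecMul (fun l => rankPair K n x (v l))
      (Matrix.of fun i j => rankPair K n (e i) (v j)).adjugate k) = cellVector K hI x k := by
    intro x k
    have h1 : (Matrix.of fun i j => rankPair K n (e i) (v j)).adjugate.map ρ = 1 := by
      have h2 := AlgHom.map_adjugate ρ (Matrix.of fun i j => rankPair K n (e i) (v j))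
      rw [AlgHom.mapMatrix_apply, AlgHom.mapMatrix_apply, hM, Matrix.adjugate_one] at h2
      exact h2
    have h3 : ∀ l, ρ ((Matrix.of fun i j => rankPair K n (e i) (v j)).adjugate l k) =
        (1 : Matrix (Fin n) (Fin n) (CellRing K I)) l k := fun l =>
      congrFun (congrFun h1 l) k
    simp [Matrix.vecMul, dotProduct, hρ, h3, Matrix.one_apply]
  have h0 := aeval_eq_zero_of_common_denominator
    (IsScalarTower.toAlgHom K (RankRing (Fin m) K n) (RankFraction (Fin m) K n))
    (IsFractionRing.injective _ _) ρ hd _ _ (fun p => det_mul_fracCoord h _ _) hf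
  have hX : ∀ p : {i // i ∈ I} × {j // j ∉ I},
      cellVector K hI p.2.1 ((I.orderIsoOfFin hI).symm p.1) = X p := by
    rintro ⟨i, j⟩
    rw [cellVector, dif_neg j.2]
    congr
    exact congrArg Subtype.val ((I.orderIsoOfFin hI).apply_symm_apply i)
  have h1 : aeval (R := K) (X : _ → CellRing K I) f = 0 := by
    rw [← h0]
    exact congrArg (fun g => aeval g f) (funext fun p => ((hN _ _).trans (hX p)).symm)
  rwa [aeval_X_left_apply] at h1

end Cell

end Swapping

theorem mainTheorem5 {K : Type*} [Field K] [CharZero K] (n m : ℕ) (hn : 2 ≤ n)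
    (I : Finset (Fin m)) (hI : I.card = n) (α β : K) :
    ∃ θ : Swapping.CellRing K I →ₐ[K] Swapping.RankFraction (Fin m) K n,
      Function.Injective θ ∧
      (∀ (i : {i // i ∈ I}) (j : {j // j ∉ I}) (v : Fin (n - 1 + 1) → Fin m),
        Function.Injective v →
          Swapping.rankDet K n
              (Fin.snoc (Swapping.omitPoint hI i) i.1 : Fin (n - 1 + 1) → Fin m) v ∈
            nonZeroDivisors (Swapping.RankRing (Fin m) K n) ∧
          θ (MvPolynomial.X (i, j)) =
            Swapping.detQuotient K n (Swapping.omitPoint hI i) j.1 i.1 v) ∧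
      ∀ f g : Swapping.CellRing K I,
        θ (Swapping.cellBracket I α β f g) =
          Swapping.rankFractionBracket (Fin m) n (β - α) (α + β) (θ f) (θ g) := by
  open Swapping MvPolynomial in
  have hnzd : ∀ k, k = n → ∀ x v : Fin k → Fin m, Function.Injective x → Function.Injective v →
      rankDet K n x v ∈ nonZeroDivisors (RankRing (Fin m) K n) := by
    rintro _ rfl x v hx hv
    exact rankDet_mem_nonZeroDivisors hn hx hv
  let e := I.orderEmbOfFin hI
  have he : Function.Injective e := (I.orderEmbOfFin hI).injective
  let v : Fin n → Fin m := e ∘ finRotate n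
  have h : rankDet K n e v ∈ nonZeroDivisors (RankRing (Fin m) K n) :=
    hnzd n rfl e v he (he.comp (finRotate n).injective)
  let idx : {i // i ∈ I} → Fin n := (I.orderIsoOfFin hI).symm
  have hidx : ∀ i, e (idx i) = i.1 := fun i =>
    congrArg Subtype.val ((I.orderIsoOfFin hI).apply_symm_apply i)
  refine ⟨aeval fun p => fracCoord K e v p.2.1 (idx p.1), aeval_fracCoord_injective hn hI h,
    fun i j w hw => ?_, ?_⟩
  · have hmem : rankDet K n (Fin.snoc (omitPoint hI i) i.1 : Fin (n - 1 + 1) → Fin m) w ∈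
        nonZeroDivisors (RankRing (Fin m) K n) := by
      refine hnzd _ (by omega) _ _ (Fin.snoc_injective_of_injective ?_ ?_) hw
      · exact (Finset.orderEmbOfFin _ _).injective
      · rintro ⟨t, ht⟩
        exact Finset.ne_of_mem_erase ((I.erase i.1).orderEmbOfFin_mem _ t) ht
    refine ⟨hmem, ?_⟩
    rw [aeval_X]
    rw [← hidx i] at hmem
    have hq := fracCoord_eq_detQuotient h (omitPoint hI i) w (idx i) (fun l hl => ?_) j.1 hmem
    · rwa [hidx] at hq
    · have hl' : e l ∈ I.erase i.1 := Finset.mem_erase.2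
        ⟨fun hc => hl (he (hc.trans (hidx i).symm)), I.orderEmbOfFin_mem hI l⟩
      rw [← Finset.mem_coe, ← Finset.range_orderEmbOfFin (I.erase i.1)
        (show (I.erase i.1).card = n - 1 by rw [Finset.card_erase_of_mem i.2, hI])] at hl'
      exact hl'
  · refine biderivation_hom_ext _ _ _ ?_
    rintro ⟨i, j⟩ ⟨i', j'⟩
    have hij : ∀ (i : {i // i ∈ I}) (j : {j // j ∉ I}), i.1 ≠ j.1 := fun i j hc =>
      j.2 (hc ▸ i.2)
    rw [cellBracket, polyBracket_X, aeval_X, aeval_X, rankFractionBracket_fracCoord h, hidx, hidx,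
      parallelNumber_eq_half_sum (hij i j) (hij i' j') (hij i j') (hij i' j),
      linking_eq_half_sum]
    simp only [fracSignature]
    rw [signature_antisymm i.1 j'.1, signature_antisymm j.1 i'.1,
      signature_antisymm i'.1 i.1, signature_antisymm j.1 j'.1]
    simp only [map_mul, map_add, map_sub, aeval_X, ← algebraMap_eq, AlgHom.commutes,
      Rat.cast_mul, Rat.cast_add, Rat.cast_neg, map_neg, Rat.cast_div, Rat.cast_one,
      Rat.cast_ofNat]
    ring
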